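/- Let $(\mathbb{X},\otimes,\top,\oplus,\bot)$ be a (not necessarily symmetric) linearly distributive category. Suppose that $\mathbb{X}$ is $*$-autonomous: every object $A$ has a chosen left linear dual $A^*$, with $\eta_{A}:\top\to A^*\oplus A$ and $\epsilon_A:A\otimes A^*\to\bot$, and a chosen right linear dual ${}^*A$, with ${}_*\eta_A:\top\to A\oplus{}^*A$ and ${}_*\epsilon_A:{}^*A\otimes A\to\bot$. Suppose further that $\mathbb{X}$ has * a cyclor, that is, a natural isomorphism $\psi_A:A^*\to{}^*A$ compatible with the canonical isomorphisms $\bot^*\cong\top\cong{}^*\bot$, $\top^*\cong\bot\cong{}^*\top$, $({}^*A)^*\cong A\cong{}^*(A^*)$, $(A\otimes B)^*\cong B^*\oplus A^*$, ${}^*(A\otimes B)\cong{}^*B\oplus{}^*A$, $(A\oplus B)^*\cong B^*\otimes A^*$, ${}^*(A\oplus B)\cong{}^*B\otimes{}^*A$; * a dagger, that is, a functor $(\_)^\dagger:\mathbb{X}^{\mathsf{op}}\to\mathbb{X}$ with natural isomorphisms $\lambda_\otimes:A^\dagger\otimes B^\dagger\to(A\oplus B)^\dagger$, $\lambda_\oplus:A^\dagger\oplus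 B^\dagger\to(A\otimes B)^\dagger$, isomorphisms $\lambda_\top:\top\to\bot^\dagger$, $\lambda_\bot:\bot\to\top^\dagger$, and a natural isomorphism $\iota_A:A\to A^{\dagger\dagger}$, which are coherent with the associators, unitors and linear distributors, such that $\iota$ is compatible with all the $\lambda$'s and $\iota_{A^\dagger}=(\iota_A^{-1})^\dagger$. Assume that the dagger preserves the cyclor: for every $A$ the composites $$A^{\dagger *}\xrightarrow{\ \cong\ }({}^*A)^\dagger\xrightarrow{\ \psi_A^\dagger\ }A^{*\dagger}\qquad\text{and}\qquad A^{\dagger *}\xrightarrow{\ \psi_{A^\dagger}\ }{}^*(A^\dagger)\xrightarrow{\ \cong\ }A^{*\dagger}$$ are equal, where the unnamed maps are the canonical isomorphisms between linear duals, obtained from the daggers of ${}_*\epsilon_A$ and of $\epsilon_A$. Write $\omega_A:A^{\dagger*}\to A^{*\dagger}$ for this composite, and write $d_A:A\to A^{**}$ for the canonical map $A\to{}^*(A^*)$ followed by $\psi_{A^*}^{-1}$. Then: 1. The functor $(\_)^{*\dagger}:\mathbb{X}\to\mathbb{X}$ is left adjoint to $(\_)^{\dagger*}:\mathbb{X}\to\mathbb{X}$,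 with unit $u_A:A\xrightarrow{d_A}A^{**}\xrightarrow{(\iota_{A^*}^{-1})^*}A^{*\dagger\dagger*}$ and counit $c_A:A^{\dagger**\dagger}\xrightarrow{(d_{A^\dagger})^\dagger}A^{\dagger\dagger}\xrightarrow{\iota_A^{-1}}A$, and this adjunction is an equivalence. 2. $\omega:(\_)^{\dagger*}\to(\_)^{*\dagger}$ is a natural isomorphism, and the unit and counit transported along it, $u_A\,\omega_{A^{*\dagger}}:A\to A^{*\dagger*\dagger}$ and $(\omega_A^{-1})^{*\dagger}\,c_A:A^{*\dagger*\dagger}\to A$ (composites in diagrammatic order), are mutually inverse. Likewise $\varepsilon_A:=\omega_{A^{\dagger*}}\,c_A:A^{\dagger*\dagger*}\to A$ and $u_A\,(\omega_A^{-1})^{\dagger*}:A\to A^{\dagger*\dagger*}$ are mutually inverse. 3. The functor $\overline{(\_)}:=(\_)^{\dagger*}$ is a conjugation on $\mathbb{X}$, so that $\mathbb{X}$ is a conjugative $*$-autonomous category. Precisely, with $$\chi_\otimes:A^{\dagger*}\otimes B^{\dagger*}\to(B^\dagger\oplus A^\dagger)^*\xrightarrow{(\lambda_\oplus^{-1})^*}(B\otimes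 A)^{\dagger*},\qquad \chi_\oplus:(A\oplus B)^{\dagger*}\xrightarrow{(\lambda_\otimes)^*}(A^\dagger\otimes B^\dagger)^*\to B^{\dagger*}\oplus A^{\dagger*}$$ (the unnamed maps being canonical), the maps $\chi_\otimes,\chi_\oplus,\varepsilon$ are natural isomorphisms; $\overline{\varepsilon_A}=\varepsilon_{\overline A}$; for each of $(\otimes,\chi_\otimes)$ and $(\oplus,\chi_\oplus^{-1})$ the map $\chi$ is coherent with the associator and satisfies $\chi_{\overline A,\overline B}\;\overline{\chi_{B,A}}\;\varepsilon=\varepsilon_A\otimes\varepsilon_B$ (respectively $\varepsilon_A\oplus\varepsilon_B$); and $\chi_\otimes,\chi_\oplus$ are compatible with both linear distributors. -/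

import Mathlib

open CategoryTheory MonoidalCategory Opposite

universe v u

/-- A second monoidal structure (the par `⊕`, written `⅋` below, with unit `⊥`) on a category. -/
class ParMonoidal (C : Type u) [Category.{v} C] where
  mon : MonoidalCategory C

section ParNotation

variable {C : Type u} [Category.{v} C] [ParMonoidal C]

/-- The par `A ⊕ B` of two objects. -/
abbrev parObj (A B : C) : C := ParMonoidal.mon.tensorObj A B

/-- The par of two maps. -/
abbrev parHom {A B A' B' : C} (f : A ⟶ B) (g : A' ⟶ B') : parObj A A' ⟶ parObj B B' :=
  ParMonoidal.mon.tensorHom f g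

/-- The map `1 ⊕ f`. -/
abbrev parWhiskerLeft (A : C) {B B' : C} (f : B ⟶ B') : parObj A B ⟶ parObj A B' :=
  ParMonoidal.mon.whiskerLeft A f

/-- The map `f ⊕ 1`. -/
abbrev parWhiskerRight {B B' : C} (f : B ⟶ B') (A : C) : parObj B A ⟶ parObj B' A :=
  ParMonoidal.mon.whiskerRight f A

/-- The unit `⊥` of the par. -/
abbrev parUnit (C : Type u) [Category.{v} C] [ParMonoidal C] : C :=
  (ParMonoidal.mon (C := C)).tensorUnit

/-- The associator of the par. -/
abbrev parAssoc (A B D : C) : parObj (parObj A B) D ≅ parObj A (parObj B D) :=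
  ParMonoidal.mon.associator A B D

/-- The left unitor `⊥ ⊕ A ≅ A`. -/
abbrev parLeftUnitor (A : C) : parObj (parUnit C) A ≅ A := ParMonoidal.mon.leftUnitor A

/-- The right unitor `A ⊕ ⊥ ≅ A`. -/
abbrev parRightUnitor (A : C) : parObj A (parUnit C) ≅ A := ParMonoidal.mon.rightUnitor A

end ParNotation

infixr:70 " ⅋ " => parObj
infixr:70 " ⅋ₘ " => parHom
infixr:81 " ◁ₚ " => parWhiskerLeft
infixl:81 " ▷ₚ " => parWhiskerRight

/-! ## Linearly distributive categories -/

/-- A (not necessarily symmetric) linearly distributive category: two monoidal structures and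
natural linear distributors, coherent with all unitors and associators. -/
class LinDistrib (C : Type u) [Category.{v} C] [MonoidalCategory C] [ParMonoidal C] where
  δL : ∀ A B D : C, A ⊗ (B ⅋ D) ⟶ (A ⊗ B) ⅋ D
  δR : ∀ A B D : C, (A ⅋ B) ⊗ D ⟶ A ⅋ (B ⊗ D)
  δL_natural : ∀ {A A' B B' D D' : C} (f : A ⟶ A') (g : B ⟶ B') (h : D ⟶ D'),
    (f ⊗ₘ (g ⅋ₘ h)) ≫ δL A' B' D' = δL A B D ≫ ((f ⊗ₘ g) ⅋ₘ h)
  δR_natural : ∀ {A A' B B' D D' : C} (f : A ⟶ A') (g : B ⟶ B') (h : D ⟶ D'),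
    ((f ⅋ₘ g) ⊗ₘ h) ≫ δR A' B' D' = δR A B D ≫ (f ⅋ₘ (g ⊗ₘ h))
  /- compatibility with the four unitors -/
  δL_tensorUnit : ∀ A B : C, δL (𝟙_ C) A B ≫ (λ_ A).hom ▷ₚ B = (λ_ (A ⅋ B)).hom
  δR_tensorUnit : ∀ A B : C, δR A B (𝟙_ C) ≫ A ◁ₚ (ρ_ B).hom = (ρ_ (A ⅋ B)).hom
  δL_parUnit : ∀ A B : C,
    δL A B (parUnit C) ≫ (parRightUnitor (A ⊗ B)).hom = A ◁ (parRightUnitor B).hom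
  δR_parUnit : ∀ A B : C,
    δR (parUnit C) A B ≫ (parLeftUnitor (A ⊗ B)).hom = (parLeftUnitor A).hom ▷ B
  /- compatibility with the associators -/
  δL_tensorAssoc : ∀ A B D E : C,
    (α_ A B (D ⅋ E)).hom ≫ A ◁ δL B D E ≫ δL A (B ⊗ D) E
      = δL (A ⊗ B) D E ≫ (α_ A B D).hom ▷ₚ E
  δR_tensorAssoc : ∀ A B D E : C,
    δR A B D ▷ E ≫ δR A (B ⊗ D) E ≫ A ◁ₚ (α_ B D E).hom
      = (α_ (A ⅋ B) D E).hom ≫ δR A B (D ⊗ E)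
  δL_parAssoc : ∀ A B D E : C,
    δL A (B ⅋ D) E ≫ δL A B D ▷ₚ E ≫ (parAssoc (A ⊗ B) D E).hom
      = A ◁ (parAssoc B D E).hom ≫ δL A B (D ⅋ E)
  δR_parAssoc : ∀ A B D E : C,
    (parAssoc A B D).hom ▷ E ≫ δR A (B ⅋ D) E ≫ A ◁ₚ δR B D E
      = δR (A ⅋ B) D E ≫ (parAssoc A B (D ⊗ E)).hom
  /- compatibility of the two distributors with each other -/
  δL_δR_tensor : ∀ A B D E : C,
    δL A B D ▷ E ≫ δR (A ⊗ B) D E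
      = (α_ A (B ⅋ D) E).hom ≫ A ◁ δR B D E ≫ δL A B (D ⊗ E)
  δL_δR_par : ∀ A B D E : C,
    δL (A ⅋ B) D E ≫ δR A B D ▷ₚ E ≫ (parAssoc A (B ⊗ D) E).hom
      = δR A B (D ⅋ E) ≫ A ◁ₚ δL B D E

section LDC

open LinDistrib

variable {C : Type u} [Category.{v} C] [MonoidalCategory C] [ParMonoidal C] [LinDistrib C]

/-! ## Linear duals -/

/-- Connecting a cup `⊤ ⟶ B ⊕ A` with a cap `A ⊗ X ⟶ ⊥` along `A` gives a map `X ⟶ B`. -/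
def lcut {A B X : C} (η : 𝟙_ C ⟶ B ⅋ A) (ε : A ⊗ X ⟶ parUnit C) : X ⟶ B :=
  (λ_ X).inv ≫ η ▷ X ≫ δR B A X ≫ B ◁ₚ ε ≫ (parRightUnitor B).hom

/-- Connecting a cup `⊤ ⟶ B ⊕ A` with a cap `X ⊗ B ⟶ ⊥` along `B` gives a map `X ⟶ A`. -/
def rcut {A B X : C} (η : 𝟙_ C ⟶ B ⅋ A) (ε : X ⊗ B ⟶ parUnit C) : X ⟶ A :=
  (ρ_ X).inv ≫ X ◁ η ≫ δL X B A ≫ ε ▷ₚ A ≫ (parLeftUnitor A).hom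

/-- `LinearDual B A`: the object `B` is left linear dual to `A` (and `A` right linear dual to
`B`), with unit `⊤ ⟶ B ⊕ A`, counit `A ⊗ B ⟶ ⊥` and the two snake equations. -/
structure LinearDual (B A : C) where
  η : 𝟙_ C ⟶ B ⅋ A
  ε : A ⊗ B ⟶ parUnit C
  snake_left : lcut η ε = 𝟙 B
  snake_right : rcut η ε = 𝟙 A

theorem δL_natural_left {A A' : C} (f : A ⟶ A') (B D : C) :
    f ▷ (B ⅋ D) ≫ δL A' B D = δL A B D ≫ (f ▷ B) ▷ₚ D := by
  have h := δL_natural f (𝟙 B) (𝟙 D)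
  have h1 : (𝟙 B ⅋ₘ 𝟙 D) = 𝟙 (B ⅋ D) := @MonoidalCategory.id_tensorHom_id C _ ParMonoidal.mon B D
  rw [h1, MonoidalCategory.tensorHom_id,
    MonoidalCategory.tensorHom_id] at h
  exact h.trans (congrArg _ (@MonoidalCategory.tensorHom_id C _ ParMonoidal.mon _ _ _ D))

theorem δL_natural_right (A B : C) {D D' : C} (h : D ⟶ D') :
    A ◁ (B ◁ₚ h) ≫ δL A B D' = δL A B D ≫ (A ⊗ B) ◁ₚ h := by
  have e := δL_natural (𝟙 A) (𝟙 B) h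
  rw [MonoidalCategory.id_tensorHom_id, MonoidalCategory.id_tensorHom] at e
  have h1 : (𝟙 B ⅋ₘ h) = B ◁ₚ h := @MonoidalCategory.id_tensorHom C _ ParMonoidal.mon B _ _ h
  rw [h1] at e
  exact e.trans (congrArg _ (@MonoidalCategory.id_tensorHom C _ ParMonoidal.mon _ _ _ h))

theorem δR_natural_left {A A' : C} (f : A ⟶ A') (B D : C) :
    (f ▷ₚ B) ▷ D ≫ δR A' B D = δR A B D ≫ f ▷ₚ (B ⊗ D) := by
  have e := δR_natural f (𝟙 B) (𝟙 D)
  rw [MonoidalCategory.id_tensorHom_id, MonoidalCategory.tensorHom_id] at e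
  have h1 : (f ⅋ₘ 𝟙 B) = f ▷ₚ B := @MonoidalCategory.tensorHom_id C _ ParMonoidal.mon _ _ f B
  rw [h1] at e
  exact e.trans (congrArg _ (@MonoidalCategory.tensorHom_id C _ ParMonoidal.mon _ _ _ _))

theorem δR_natural_right (A B : C) {D D' : C} (h : D ⟶ D') :
    (A ⅋ B) ◁ h ≫ δR A B D' = δR A B D ≫ A ◁ₚ (B ◁ h) := by
  have e := δR_natural (𝟙 A) (𝟙 B) h
  have h1 : (𝟙 A ⅋ₘ 𝟙 B) = 𝟙 (A ⅋ B) := @MonoidalCategory.id_tensorHom_id C _ ParMonoidal.mon A B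
  rw [h1, MonoidalCategory.id_tensorHom,
    MonoidalCategory.id_tensorHom] at e
  exact e.trans (congrArg _ (@MonoidalCategory.id_tensorHom C _ ParMonoidal.mon A _ _ _))

theorem comp_lcut {A B X Y : C} (k : Y ⟶ X) (η : 𝟙_ C ⟶ B ⅋ A) (ε : A ⊗ X ⟶ parUnit C) :
    k ≫ lcut η ε = lcut η (A ◁ k ≫ ε) := by
  have h3 : B ◁ₚ (A ◁ k ≫ ε) = B ◁ₚ (A ◁ k) ≫ B ◁ₚ ε :=
    @MonoidalCategory.whiskerLeft_comp C _ ParMonoidal.mon B _ _ _ _ _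
  unfold lcut
  rw [h3, Category.assoc, ← reassoc_of% (δR_natural_right B A k), ← whisker_exchange_assoc,
    leftUnitor_inv_naturality_assoc]

theorem comp_rcut {A B X Y : C} (k : Y ⟶ X) (η : 𝟙_ C ⟶ B ⅋ A) (ε : X ⊗ B ⟶ parUnit C) :
    k ≫ rcut η ε = rcut η (k ▷ B ≫ ε) := by
  have h3 : (k ▷ B ≫ ε) ▷ₚ A = (k ▷ B) ▷ₚ A ≫ ε ▷ₚ A :=
    @MonoidalCategory.comp_whiskerRight C _ ParMonoidal.mon _ _ _ _ _ A
  unfold rcut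
  rw [h3, Category.assoc, ← reassoc_of% (δL_natural_left k B A), whisker_exchange_assoc,
    rightUnitor_inv_naturality_assoc]

theorem LinearDual.lcut_ε {A B X : C} (d : LinearDual B A) (e : A ⊗ X ⟶ parUnit C) :
    A ◁ lcut d.η e ≫ d.ε = e := by
  have h1 : (parRightUnitor (A ⊗ B)).hom ≫ d.ε
      = d.ε ▷ₚ parUnit C ≫ (parRightUnitor (parUnit C)).hom :=
    (@MonoidalCategory.rightUnitor_naturality C _ ParMonoidal.mon _ _ d.ε).symm
  have h2 : (A ⊗ B) ◁ₚ e ≫ d.ε ▷ₚ parUnit C = d.ε ▷ₚ (A ⊗ X) ≫ parUnit C ◁ₚ e :=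
    @MonoidalCategory.whisker_exchange C _ ParMonoidal.mon _ _ _ _ _ _
  have h3 : (parRightUnitor (parUnit C)).hom = (parLeftUnitor (parUnit C)).hom :=
    (@MonoidalCategory.unitors_equal C _ ParMonoidal.mon).symm
  have h4 : parUnit C ◁ₚ e ≫ (parLeftUnitor (parUnit C)).hom = (parLeftUnitor (A ⊗ X)).hom ≫ e :=
    @MonoidalCategory.leftUnitor_naturality C _ ParMonoidal.mon _ _ e
  have h5 := d.snake_right
  unfold rcut at h5
  have h6 := congrArg (fun t => t ▷ X) h5
  simp only [comp_whiskerRight, id_whiskerRight] at h6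
  unfold lcut
  simp only [MonoidalCategory.whiskerLeft_comp, Category.assoc]
  rw [← δL_parUnit A B, Category.assoc, reassoc_of% (δL_natural_right A B e), h1, reassoc_of% h2,
    h3, h4]
  have h8 : A ◁ δR B A X ≫ δL A B (A ⊗ X)
      = (α_ A (B ⅋ A) X).inv ≫ δL A B A ▷ X ≫ δR (A ⊗ B) A X := by
    rw [δL_δR_tensor, Iso.inv_hom_id_assoc]
  rw [reassoc_of% h8, ← reassoc_of% (δR_natural_left d.ε A X), reassoc_of% (δR_parUnit A X)]
  have h9 : A ◁ (λ_ X).inv ≫ A ◁ d.η ▷ X ≫ (α_ A (B ⅋ A) X).inv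
      = (ρ_ A).inv ▷ X ≫ (A ◁ d.η) ▷ X := by
    rw [associator_inv_naturality_middle]
    simp
  rw [reassoc_of% h9, reassoc_of% h6]

theorem LinearDual.rcut_ε {A B X : C} (d : LinearDual B A) (e : X ⊗ B ⟶ parUnit C) :
    rcut d.η e ▷ B ≫ d.ε = e := by
  have h1 : (parLeftUnitor (A ⊗ B)).hom ≫ d.ε
      = parUnit C ◁ₚ d.ε ≫ (parLeftUnitor (parUnit C)).hom :=
    (@MonoidalCategory.leftUnitor_naturality C _ ParMonoidal.mon _ _ d.ε).symm
  have h2 : e ▷ₚ (A ⊗ B) ≫ parUnit C ◁ₚ d.ε = (X ⊗ B) ◁ₚ d.ε ≫ e ▷ₚ parUnit C :=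
    (@MonoidalCategory.whisker_exchange C _ ParMonoidal.mon _ _ _ _ _ _).symm
  have h3 : (parLeftUnitor (parUnit C)).hom = (parRightUnitor (parUnit C)).hom :=
    @MonoidalCategory.unitors_equal C _ ParMonoidal.mon
  have h4 : e ▷ₚ parUnit C ≫ (parRightUnitor (parUnit C)).hom
      = (parRightUnitor (X ⊗ B)).hom ≫ e :=
    @MonoidalCategory.rightUnitor_naturality C _ ParMonoidal.mon _ _ e
  have h5 := d.snake_left
  unfold lcut at h5
  have h6 := congrArg (fun t => X ◁ t) h5
  simp only [MonoidalCategory.whiskerLeft_comp, MonoidalCategory.whiskerLeft_id] at h6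
  unfold rcut
  simp only [comp_whiskerRight, Category.assoc]
  rw [← δR_parUnit A B, Category.assoc, reassoc_of% (δR_natural_left e A B), h1, reassoc_of% h2,
    h3, h4]
  rw [reassoc_of% (δL_δR_tensor X B A B), ← reassoc_of% (δL_natural_right X B d.ε),
    reassoc_of% (δL_parUnit X B)]
  have h9 : (ρ_ X).inv ▷ B ≫ (X ◁ d.η) ▷ B ≫ (α_ X (B ⅋ A) B).hom
      = X ◁ (λ_ B).inv ≫ X ◁ (d.η ▷ B) := by
    rw [associator_naturality_middle]
    simp
  rw [reassoc_of% h9, reassoc_of% h6]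

/-- The map `B' ⟶ B` between left duals induced by `f : A ⟶ A'`. -/
def LinearDual.lmate {A B A' B' : C} (d : LinearDual B A) (d' : LinearDual B' A') (f : A ⟶ A') :
    B' ⟶ B :=
  lcut d.η (f ▷ B' ≫ d'.ε)

/-- The map `A' ⟶ A` between right duals induced by `g : B ⟶ B'`. -/
def LinearDual.rmate {A B A' B' : C} (d : LinearDual B A) (d' : LinearDual B' A') (g : B ⟶ B') :
    A' ⟶ A :=
  rcut d.η (A' ◁ g ≫ d'.ε)

theorem LinearDual.lmate_id {A B : C} (d : LinearDual B A) : d.lmate d (𝟙 A) = 𝟙 B := by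
  simp [LinearDual.lmate, d.snake_left]

theorem LinearDual.rmate_id {A B : C} (d : LinearDual B A) : d.rmate d (𝟙 B) = 𝟙 A := by
  simp [LinearDual.rmate, d.snake_right]

theorem LinearDual.lmate_comp {A B A' B' A'' B'' : C} (d : LinearDual B A)
    (d' : LinearDual B' A') (d'' : LinearDual B'' A'') (f : A ⟶ A') (g : A' ⟶ A'') :
    d.lmate d'' (f ≫ g) = d'.lmate d'' g ≫ d.lmate d' f := by
  unfold LinearDual.lmate
  rw [comp_lcut, whisker_exchange_assoc, d'.lcut_ε, comp_whiskerRight, Category.assoc]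

theorem LinearDual.rmate_comp {A B A' B' A'' B'' : C} (d : LinearDual B A)
    (d' : LinearDual B' A') (d'' : LinearDual B'' A'') (f : B ⟶ B') (g : B' ⟶ B'') :
    d.rmate d'' (f ≫ g) = d'.rmate d'' g ≫ d.rmate d' f := by
  unfold LinearDual.rmate
  rw [comp_rcut, ← whisker_exchange_assoc, d'.rcut_ε, MonoidalCategory.whiskerLeft_comp,
    Category.assoc]

/-! ## Nested cups and caps -/

/-- Nesting the cup on `Z, W` inside the cup on `X, Y`, with cups grouped as
`(X ⊕ Z) ⊕ (W ⊗ Y)`. -/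
def nestParTensor {X Y Z W : C} (s : 𝟙_ C ⟶ X ⅋ Y) (t : 𝟙_ C ⟶ Z ⅋ W) :
    𝟙_ C ⟶ (X ⅋ Z) ⅋ (W ⊗ Y) :=
  s ≫ X ◁ₚ ((λ_ Y).inv ≫ t ▷ Y ≫ δR Z W Y) ≫ (parAssoc X Z (W ⊗ Y)).inv

/-- Nesting the cup on `Z, W` inside the cup on `X, Y`, with cups grouped as
`(X ⊗ Z) ⊕ (W ⊕ Y)`. -/
def nestTensorPar {X Y Z W : C} (s : 𝟙_ C ⟶ X ⅋ Y) (t : 𝟙_ C ⟶ Z ⅋ W) :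
    𝟙_ C ⟶ (X ⊗ Z) ⅋ (W ⅋ Y) :=
  s ≫ ((ρ_ X).inv ≫ X ◁ t ≫ δL X Z W) ▷ₚ Y ≫ (parAssoc (X ⊗ Z) W Y).hom

/-- Nesting the cap on `W, Z` inside the cap on `Y, X`. -/
def nestCap {X Y Z W : C} (s : Y ⊗ X ⟶ parUnit C) (t : W ⊗ Z ⟶ parUnit C) :
    (Y ⅋ W) ⊗ (Z ⊗ X) ⟶ parUnit C :=
  (α_ (Y ⅋ W) Z X).inv ≫ (δR Y W Z ≫ Y ◁ₚ t ≫ (parRightUnitor Y).hom) ▷ X ≫ s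

end LDC

/-! ## `*`-autonomous categories -/

/-- A `*`-autonomous category: a linearly distributive category in which every object `A` has a
chosen left linear dual `A^*` and a chosen right linear dual `^*A`. -/
class StarAutonomous (C : Type u) [Category.{v} C] [MonoidalCategory C] [ParMonoidal C]
    [LinDistrib C] where
  lstar : C → C
  rstar : C → C
  ldual : ∀ A : C, LinearDual (lstar A) A
  rdual : ∀ A : C, LinearDual A (rstar A)

section Star

open LinDistrib StarAutonomous

variable (C : Type u) [Category.{v} C] [MonoidalCategory C] [ParMonoidal C] [LinDistrib C]
  [StarAutonomous C]

/-- The contravariant functor `A ↦ A^*`. -/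
def lstarFunctor : Cᵒᵖ ⥤ C where
  obj A := lstar A.unop
  map {A B} f := (ldual B.unop).lmate (ldual A.unop) f.unop
  map_id A := (ldual A.unop).lmate_id
  map_comp f g := LinearDual.lmate_comp _ _ _ g.unop f.unop

/-- The contravariant functor `A ↦ ^*A`. -/
def rstarFunctor : Cᵒᵖ ⥤ C where
  obj A := rstar A.unop
  map {A B} f := (rdual B.unop).rmate (rdual A.unop) f.unop
  map_id A := (rdual A.unop).rmate_id
  map_comp f g := LinearDual.rmate_comp _ _ _ g.unop f.unop

variable {C}

/-- The map `f^* : B^* ⟶ A^*` of `f : A ⟶ B`. -/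
abbrev lstarMap {A B : C} (f : A ⟶ B) : lstar B ⟶ lstar A := (lstarFunctor C).map f.op

/-- The canonical map `A^* ⊗ B^* ⟶ (B ⊕ A)^*`. -/
def starTensor (A B : C) : lstar A ⊗ lstar B ⟶ lstar (B ⅋ A) :=
  lcut (ldual (B ⅋ A)).η (nestCap (ldual B).ε (ldual A).ε)

/-- The canonical map `(A ⊗ B)^* ⟶ B^* ⊕ A^*`. -/
def starPar (A B : C) : lstar (A ⊗ B) ⟶ lstar B ⅋ lstar A :=
  lcut (nestParTensor (ldual B).η (ldual A).η) (ldual (A ⊗ B)).ε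

variable (C)

/-- A cyclor: a natural isomorphism `ψ : A^* ⟶ ^*A` compatible with the canonical isomorphisms
of the units, the double duals, the tensor and the par. -/
structure Cyclor where
  ψ : lstarFunctor C ≅ rstarFunctor C
  /-- Both ways `⊥^* ⟶ ⊤` agree. -/
  parUnit_coh :
    (ψ.hom.app (op (parUnit C)) : lstar (parUnit C) ⟶ rstar (parUnit C))
        ≫ rcut (parLeftUnitor (𝟙_ C)).inv (rdual (parUnit C)).ε
      = lcut (parRightUnitor (𝟙_ C)).inv (ldual (parUnit C)).ε
  /-- Both ways `A ⟶ ^*(A^*)` agree. -/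
  double_coh : ∀ A : C,
    lcut (ldual (rstar A)).η (rdual A).ε ≫ lstarMap (ψ.hom.app (op A) : lstar A ⟶ rstar A)
        ≫ ψ.hom.app (op (lstar A))
      = rcut (rdual (lstar A)).η (ldual A).ε
  /-- Both ways `⊤^* ⟶ ⊥` agree. -/
  tensorUnit_coh :
    (ψ.hom.app (op (𝟙_ C)) : lstar (𝟙_ C) ⟶ rstar (𝟙_ C))
        ≫ (ρ_ (rstar (𝟙_ C))).inv ≫ (rdual (𝟙_ C)).ε
      = (λ_ (lstar (𝟙_ C))).inv ≫ (ldual (𝟙_ C)).ε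
  /-- Both ways `(A ⊗ B)^* ⟶ ^*B ⊕ ^*A` agree. -/
  tensor_coh : ∀ A B : C,
    (ψ.hom.app (op (A ⊗ B)) : lstar (A ⊗ B) ⟶ rstar (A ⊗ B))
        ≫ rcut (nestTensorPar (rdual A).η (rdual B).η) (rdual (A ⊗ B)).ε
      = starPar A B ≫ ((ψ.hom.app (op B) : lstar B ⟶ rstar B) ⅋ₘ
          (ψ.hom.app (op A) : lstar A ⟶ rstar A))
  /-- Both ways `(A ⊕ B)^* ⟶ ^*B ⊗ ^*A` agree. -/
  par_coh : ∀ A B : C,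
    (ψ.hom.app (op (A ⅋ B)) : lstar (A ⅋ B) ⟶ rstar (A ⅋ B))
        ≫ rcut (nestParTensor (rdual A).η (rdual B).η) (rdual (A ⅋ B)).ε
      = lcut (nestTensorPar (ldual B).η (ldual A).η) (ldual (A ⅋ B)).ε
        ≫ ((ψ.hom.app (op B) : lstar B ⟶ rstar B) ⊗ₘ
          (ψ.hom.app (op A) : lstar A ⟶ rstar A))

variable {C}

/-- The component `ψ_A : A^* ⟶ ^*A` of a cyclor. -/
def Cyclor.app (c : Cyclor C) (A : C) : lstar A ⟶ rstar A := c.ψ.hom.app (op A)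

/-- The inverse `^*A ⟶ A^*` of `ψ_A`. -/
def Cyclor.invApp (c : Cyclor C) (A : C) : rstar A ⟶ lstar A := c.ψ.inv.app (op A)

/-- The dualizor `A ⟶ A^{**}`: the canonical map `A ⟶ ^*(A^*)` followed by `ψ⁻¹`. -/
def Cyclor.dualizor (c : Cyclor C) (A : C) : A ⟶ lstar (lstar A) :=
  rcut (rdual (lstar A)).η (ldual A).ε ≫ c.invApp (lstar A)

end Star

/-! ## Dagger linearly distributive categories -/

/-- A dagger linearly distributive category: a contravariant functor `(_)^†` with invertible
laxors exchanging the two monoidal structures and an involutor `ι : A ≅ A^{††}`. -/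
class DaggerLDC (C : Type u) [Category.{v} C] [MonoidalCategory C] [ParMonoidal C]
    [LinDistrib C] where
  dag : Cᵒᵖ ⥤ C
  lamT : ∀ A B : C, dag.obj (op A) ⊗ dag.obj (op B) ≅ dag.obj (op (A ⅋ B))
  lamP : ∀ A B : C, dag.obj (op A) ⅋ dag.obj (op B) ≅ dag.obj (op (A ⊗ B))
  lamTop : 𝟙_ C ≅ dag.obj (op (parUnit C))
  lamBot : parUnit C ≅ dag.obj (op (𝟙_ C))
  ι : 𝟭 C ≅ dag.rightOp ⋙ dag
  lamT_natural : ∀ {A A' B B' : C} (f : A ⟶ A') (g : B ⟶ B'),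
    (dag.map f.op ⊗ₘ dag.map g.op) ≫ (lamT A B).hom = (lamT A' B').hom ≫ dag.map (f ⅋ₘ g).op
  lamP_natural : ∀ {A A' B B' : C} (f : A ⟶ A') (g : B ⟶ B'),
    (dag.map f.op ⅋ₘ dag.map g.op) ≫ (lamP A B).hom = (lamP A' B').hom ≫ dag.map (f ⊗ₘ g).op
  /- laxors and associators -/
  lamT_assoc : ∀ A B D : C,
    (α_ (dag.obj (op A)) (dag.obj (op B)) (dag.obj (op D))).inv
        ≫ (lamT A B).hom ▷ dag.obj (op D) ≫ (lamT (A ⅋ B) D).hom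
      = dag.obj (op A) ◁ (lamT B D).hom ≫ (lamT A (B ⅋ D)).hom
        ≫ dag.map (parAssoc A B D).hom.op
  lamP_assoc : ∀ A B D : C,
    (parAssoc (dag.obj (op A)) (dag.obj (op B)) (dag.obj (op D))).inv
        ≫ (lamP A B).hom ▷ₚ dag.obj (op D) ≫ (lamP (A ⊗ B) D).hom
      = dag.obj (op A) ◁ₚ (lamP B D).hom ≫ (lamP A (B ⊗ D)).hom
        ≫ dag.map (α_ A B D).hom.op
  /- laxors and unitors -/
  lamT_left : ∀ A : C,
    lamTop.hom ▷ dag.obj (op A) ≫ (lamT (parUnit C) A).hom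
      = (λ_ (dag.obj (op A))).hom ≫ dag.map (parLeftUnitor A).hom.op
  lamT_right : ∀ A : C,
    dag.obj (op A) ◁ lamTop.hom ≫ (lamT A (parUnit C)).hom
      = (ρ_ (dag.obj (op A))).hom ≫ dag.map (parRightUnitor A).hom.op
  lamP_left : ∀ A : C,
    lamBot.hom ▷ₚ dag.obj (op A) ≫ (lamP (𝟙_ C) A).hom
      = (parLeftUnitor (dag.obj (op A))).hom ≫ dag.map (λ_ A).hom.op
  lamP_right : ∀ A : C,
    dag.obj (op A) ◁ₚ lamBot.hom ≫ (lamP A (𝟙_ C)).hom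
      = (parRightUnitor (dag.obj (op A))).hom ≫ dag.map (ρ_ A).hom.op
  /- laxors and linear distributors -/
  lam_δL : ∀ A B D : C,
    LinDistrib.δL (dag.obj (op A)) (dag.obj (op B)) (dag.obj (op D))
        ≫ (lamT A B).hom ▷ₚ dag.obj (op D) ≫ (lamP (A ⅋ B) D).hom
      = dag.obj (op A) ◁ (lamP B D).hom ≫ (lamT A (B ⊗ D)).hom
        ≫ dag.map (LinDistrib.δR A B D).op
  lam_δR : ∀ A B D : C,
    LinDistrib.δR (dag.obj (op A)) (dag.obj (op B)) (dag.obj (op D))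
        ≫ dag.obj (op A) ◁ₚ (lamT B D).hom ≫ (lamP A (B ⅋ D)).hom
      = (lamP A B).hom ▷ dag.obj (op D) ≫ (lamT (A ⊗ B) D).hom
        ≫ dag.map (LinDistrib.δL A B D).op
  /- involutor and laxors -/
  ι_par : ∀ A B : C,
    ι.hom.app (A ⅋ B) ≫ dag.map (lamT A B).hom.op
      = (ι.hom.app A ⅋ₘ ι.hom.app B) ≫ (lamP (dag.obj (op A)) (dag.obj (op B))).hom
  ι_tensor : ∀ A B : C,
    ι.hom.app (A ⊗ B) ≫ dag.map (lamP A B).hom.op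
      = (ι.hom.app A ⊗ₘ ι.hom.app B) ≫ (lamT (dag.obj (op A)) (dag.obj (op B))).hom
  ι_parUnit : ι.hom.app (parUnit C) ≫ dag.map lamTop.hom.op = lamBot.hom
  ι_tensorUnit : ι.hom.app (𝟙_ C) ≫ dag.map lamBot.hom.op = lamTop.hom
  ι_dag : ∀ A : C, ι.hom.app (dag.obj (op A)) = dag.map (ι.inv.app A).op

section Dagger

open StarAutonomous

variable {C : Type u} [Category.{v} C] [MonoidalCategory C] [ParMonoidal C] [LinDistrib C]
  [DaggerLDC C]

/-- The object `A^†`. -/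
abbrev dg (A : C) : C := DaggerLDC.dag.obj (op A)

/-- The map `f^† : B^† ⟶ A^†` of `f : A ⟶ B`. -/
abbrev dgMap {A B : C} (f : A ⟶ B) : dg B ⟶ dg A := DaggerLDC.dag.map f.op

/-- The involutor `A ⟶ A^{††}`. -/
abbrev involutor (A : C) : A ⟶ dg (dg A) := DaggerLDC.ι.hom.app A

/-- The inverse `A^{††} ⟶ A` of the involutor. -/
abbrev involutorInv (A : C) : dg (dg A) ⟶ A := DaggerLDC.ι.inv.app A

/-- The dagger of a cap `X ⊗ Y ⟶ ⊥`, as a cup `⊤ ⟶ X^† ⊕ Y^†`. -/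
def dagCup {X Y : C} (ε : X ⊗ Y ⟶ parUnit C) : 𝟙_ C ⟶ dg X ⅋ dg Y :=
  DaggerLDC.lamTop.hom ≫ dgMap ε ≫ (DaggerLDC.lamP X Y).inv

variable [StarAutonomous C]

/-- The dagger preserves the cyclor: the two composites `A^{†*} ⟶ (^*A)^† ⟶ A^{*†}` and
`A^{†*} ⟶ ^*(A^†) ⟶ A^{*†}` agree, where the unnamed maps are the canonical isomorphisms. -/
def Cyclor.PreservedByDagger (c : Cyclor C) : Prop :=
  ∀ A : C,
    lcut (dagCup (rdual A).ε) (ldual (dg A)).ε ≫ dgMap (c.app A)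
      = c.app (dg A) ≫ rcut (dagCup (ldual A).ε) (rdual (dg A)).ε

/-- The map `ω_A : A^{†*} ⟶ A^{*†}`: the canonical map `A^{†*} ⟶ (^*A)^†` followed by `ψ^†`. -/
def Cyclor.omega (c : Cyclor C) (A : C) : lstar (dg A) ⟶ dg (lstar A) :=
  lcut (dagCup (rdual A).ε) (ldual (dg A)).ε ≫ dgMap (c.app A)

/-- The map `A ⟶ A^{*††*}` obtained from the dualizor and the involutor. -/
def Cyclor.compositeUnit (c : Cyclor C) (A : C) : A ⟶ lstar (dg (dg (lstar A))) :=
  c.dualizor A ≫ lstarMap (involutorInv (lstar A))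

/-- The map `A^{†**†} ⟶ A` obtained from the dualizor and the involutor. -/
def Cyclor.compositeCounit (c : Cyclor C) (A : C) : dg (lstar (lstar (dg A))) ⟶ A :=
  dgMap (c.dualizor (dg A)) ≫ involutorInv A

variable (C)

/-- The covariant functor `A ↦ A^{*†}`. -/
def starDagger : C ⥤ C := (lstarFunctor C).rightOp ⋙ DaggerLDC.dag

/-- The covariant functor `A ↦ A^{†*}`. -/
def daggerStar : C ⥤ C := (DaggerLDC.dag (C := C)).rightOp ⋙ lstarFunctor C

variable {C}

/-- The laxor `A^{†*} ⊗ B^{†*} ⟶ (B ⊗ A)^{†*}`. -/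
def daggerStarTensor (A B : C) : lstar (dg A) ⊗ lstar (dg B) ⟶ lstar (dg (B ⊗ A)) :=
  starTensor (dg A) (dg B) ≫ lstarMap (DaggerLDC.lamP B A).inv

/-- The laxor `(A ⊕ B)^{†*} ⟶ B^{†*} ⊕ A^{†*}`. -/
def daggerStarPar (A B : C) : lstar (dg (A ⅋ B)) ⟶ lstar (dg B) ⅋ lstar (dg A) :=
  lstarMap (DaggerLDC.lamT A B).hom ≫ starPar (dg A) (dg B)

end Dagger

/-! ## Conjugation -/

/-- A conjugation for a monoidal category `M` on `C`: a tensor-reversing functor `bar` with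
conjugating laxor `χ` and conjugator `ε`. -/
structure IsConjugation {C : Type u} [Category.{v} C] (M : MonoidalCategory C) (bar : C ⥤ C)
    (χ : ∀ A B : C, M.tensorObj (bar.obj A) (bar.obj B) ≅ bar.obj (M.tensorObj B A))
    (ε : bar ⋙ bar ≅ 𝟭 C) : Prop where
  χ_natural : ∀ {A A' B B' : C} (f : A ⟶ A') (g : B ⟶ B'),
    M.tensorHom (bar.map f) (bar.map g) ≫ (χ A' B').hom
      = (χ A B).hom ≫ bar.map (M.tensorHom g f)
  bar_ε : ∀ A : C, bar.map (ε.hom.app A) = ε.hom.app (bar.obj A)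
  assoc : ∀ A B D : C,
    (M.associator (bar.obj A) (bar.obj B) (bar.obj D)).hom
        ≫ M.whiskerLeft (bar.obj A) (χ B D).hom ≫ (χ A (M.tensorObj D B)).hom
      = M.whiskerRight (χ A B).hom (bar.obj D) ≫ (χ (M.tensorObj B A) D).hom
        ≫ bar.map (M.associator D B A).inv
  ε_χ : ∀ A B : C,
    (χ (bar.obj A) (bar.obj B)).hom ≫ bar.map (χ B A).hom ≫ ε.hom.app (M.tensorObj A B)
      = M.tensorHom (ε.hom.app A) (ε.hom.app B)

/-- A conjugation on a linearly distributive category with underlying functor `bar`: it is a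
conjugation for both monoidal structures, compatible with the linear distributors. -/
structure LDCConjugation {C : Type u} [Category.{v} C] [T : MonoidalCategory C] [ParMonoidal C]
    [LinDistrib C] (bar : C ⥤ C) where
  χT : ∀ A B : C, bar.obj A ⊗ bar.obj B ≅ bar.obj (B ⊗ A)
  χP : ∀ A B : C, bar.obj (A ⅋ B) ≅ bar.obj B ⅋ bar.obj A
  ε : bar ⋙ bar ≅ 𝟭 C
  tensor : IsConjugation T bar χT ε
  par : IsConjugation ParMonoidal.mon bar (fun A B => (χP B A).symm) ε
  δ_left : ∀ A B D : C,
    (χP B D).hom ▷ bar.obj A ≫ LinDistrib.δR (bar.obj D) (bar.obj B) (bar.obj A)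
        ≫ bar.obj D ◁ₚ (χT B A).hom
      = (χT (B ⅋ D) A).hom ≫ bar.map (LinDistrib.δL A B D) ≫ (χP (A ⊗ B) D).hom
  δ_right : ∀ A B D : C,
    bar.obj A ◁ (χP D B).hom ≫ LinDistrib.δL (bar.obj A) (bar.obj B) (bar.obj D)
        ≫ (χT A B).hom ▷ₚ bar.obj D
      = (χT A (D ⅋ B)).hom ≫ bar.map (LinDistrib.δR D B A) ≫ (χP D (B ⊗ A)).hom

/-! A linear dual is governed by its cap: a map into `B` is known once it is paired with `ε : A ⊗ B
⟶ ⊥` (`LinearDual.left_ext`, and dually `LinearDual.right_ext`). Coherence laws for `(_)^*` thus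
become equalities of caps. The caps of `A ⊗ B` and `A ⊕ B` are nested caps of the factors
(`starParIso_inv_ε`, `starTensor_ε`), and the laws for associators and distributors say that three
concentric caps may be grouped in any way.

The cyclor makes `A^*` a right dual of `A` as well (`Cyclor.rightDual`). Its coherence axioms say
that these right caps nest in the same way and that `d_A` carries left caps to right caps. The
dagger turns caps into cups, hence duals into duals, so `A^{*†}` and `A^{†*}` are both left duals of
`A^†`, and `ω_A` is the comparison between them. The triangle identities of the adjunction come down
to `d_{A^*} (d_A)^* = 1` and `ι_{A^†} = (ι_A⁻¹)^†`.

The central object is `s_A : A^* ≅ A^{†*†}`, the composite of `ι` and `ω_A^†` (`Cyclor.starConj`).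
`A` is left dual to `A^*` through the right cap, and `A^{†*†*}` is left dual to `A^{†*†}`. Under
these pairings `ω_{A^{†*}} c_A` is the mate of `s_A`, and `u_A (ω_A⁻¹)^{†*}` undoes it
(`Cyclor.conjugator_ε`, `Cyclor.conjugatorInv_ε`), so the two are mutually inverse. After cancelling
`ω` against its inverse, the law for the conjugator of a conjugate is a triangle identity.
Compatibility of the conjugator with the laxors reduces to that of `s_A` (`Cyclor.starConj_par`,
`Cyclor.starConj_tensor`), which is again a comparison of nested caps. -/

/-! ### Monoidal identities for the par. -/

section ParLemmas

variable {C : Type u} [Category.{v} C] [ParMonoidal C]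

theorem par_whiskerLeft_comp (A : C) {X Y Z : C} (f : X ⟶ Y) (g : Y ⟶ Z) :
    A ◁ₚ (f ≫ g) = A ◁ₚ f ≫ A ◁ₚ g :=
  @MonoidalCategory.whiskerLeft_comp C _ ParMonoidal.mon A _ _ _ f g

theorem par_comp_whiskerRight {X Y Z : C} (f : X ⟶ Y) (g : Y ⟶ Z) (A : C) :
    (f ≫ g) ▷ₚ A = f ▷ₚ A ≫ g ▷ₚ A :=
  @MonoidalCategory.comp_whiskerRight C _ ParMonoidal.mon _ _ _ f g A

theorem par_whiskerLeft_id (A X : C) : A ◁ₚ 𝟙 X = 𝟙 (A ⅋ X) :=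
  @MonoidalCategory.whiskerLeft_id C _ ParMonoidal.mon A X

theorem par_id_whiskerRight (A X : C) : 𝟙 X ▷ₚ A = 𝟙 (X ⅋ A) :=
  @MonoidalCategory.id_whiskerRight C _ ParMonoidal.mon X A

theorem par_whisker_exchange {W X Y Z : C} (f : W ⟶ X) (g : Y ⟶ Z) :
    W ◁ₚ g ≫ f ▷ₚ Z = f ▷ₚ Y ≫ X ◁ₚ g :=
  @MonoidalCategory.whisker_exchange C _ ParMonoidal.mon _ _ _ _ f g

theorem par_tensorHom_def {W X Y Z : C} (f : W ⟶ X) (g : Y ⟶ Z) :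
    (f ⅋ₘ g) = f ▷ₚ Y ≫ X ◁ₚ g :=
  @MonoidalCategory.tensorHom_def C _ ParMonoidal.mon _ _ _ _ f g

theorem par_leftUnitor_naturality {X Y : C} (f : X ⟶ Y) :
    parUnit C ◁ₚ f ≫ (parLeftUnitor Y).hom = (parLeftUnitor X).hom ≫ f :=
  @MonoidalCategory.leftUnitor_naturality C _ ParMonoidal.mon _ _ f

theorem par_rightUnitor_naturality {X Y : C} (f : X ⟶ Y) :
    f ▷ₚ parUnit C ≫ (parRightUnitor Y).hom = (parRightUnitor X).hom ≫ f :=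
  @MonoidalCategory.rightUnitor_naturality C _ ParMonoidal.mon _ _ f

theorem par_associator_naturality_left {X X' : C} (f : X ⟶ X') (Y Z : C) :
    (f ▷ₚ Y) ▷ₚ Z ≫ (parAssoc X' Y Z).hom = (parAssoc X Y Z).hom ≫ f ▷ₚ (Y ⅋ Z) :=
  @MonoidalCategory.associator_naturality_left C _ ParMonoidal.mon _ _ f Y Z

theorem par_associator_naturality_right (X Y : C) {Z Z' : C} (f : Z ⟶ Z') :
    (X ⅋ Y) ◁ₚ f ≫ (parAssoc X Y Z').hom = (parAssoc X Y Z).hom ≫ X ◁ₚ (Y ◁ₚ f) :=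
  @MonoidalCategory.associator_naturality_right C _ ParMonoidal.mon X Y _ _ f

theorem par_associator_inv_naturality_left {X X' : C} (f : X ⟶ X') (Y Z : C) :
    f ▷ₚ (Y ⅋ Z) ≫ (parAssoc X' Y Z).inv = (parAssoc X Y Z).inv ≫ (f ▷ₚ Y) ▷ₚ Z :=
  @MonoidalCategory.associator_inv_naturality_left C _ ParMonoidal.mon _ _ f Y Z

theorem par_associator_inv_naturality_middle (X : C) {Y Y' : C} (f : Y ⟶ Y') (Z : C) :
    X ◁ₚ (f ▷ₚ Z) ≫ (parAssoc X Y' Z).inv = (parAssoc X Y Z).inv ≫ (X ◁ₚ f) ▷ₚ Z :=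
  @MonoidalCategory.associator_inv_naturality_middle C _ ParMonoidal.mon X _ _ f Z

theorem par_triangle_inv (X Y : C) :
    (parAssoc X (parUnit C) Y).inv ≫ (parRightUnitor X).hom ▷ₚ Y = X ◁ₚ (parLeftUnitor Y).hom :=
  @MonoidalCategory.triangle_assoc_comp_right C _ ParMonoidal.mon X Y

theorem par_rightUnitor_tensor (X Y : C) :
    (parRightUnitor (X ⅋ Y)).hom
      = (parAssoc X Y (parUnit C)).hom ≫ X ◁ₚ (parRightUnitor Y).hom :=
  @MonoidalCategory.rightUnitor_tensor_hom C _ ParMonoidal.mon X Y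

theorem par_leftUnitor_tensor (X Y : C) :
    (parLeftUnitor (X ⅋ Y)).hom
      = (parAssoc (parUnit C) X Y).inv ≫ (parLeftUnitor X).hom ▷ₚ Y :=
  @MonoidalCategory.leftUnitor_tensor_hom C _ ParMonoidal.mon X Y

theorem par_unitors_equal : (parLeftUnitor (parUnit C)).hom = (parRightUnitor (parUnit C)).hom :=
  @MonoidalCategory.unitors_equal C _ ParMonoidal.mon

theorem par_hom_inv_whiskerRight {X Y : C} (e : X ≅ Y) (A : C) :
    e.hom ▷ₚ A ≫ e.inv ▷ₚ A = 𝟙 (X ⅋ A) := by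
  rw [← par_comp_whiskerRight, e.hom_inv_id, par_id_whiskerRight]

theorem par_whiskerLeft_hom_inv (A : C) {X Y : C} (e : X ≅ Y) :
    A ◁ₚ e.hom ≫ A ◁ₚ e.inv = 𝟙 (A ⅋ X) := by
  rw [← par_whiskerLeft_comp, e.hom_inv_id, par_whiskerLeft_id]

theorem par_inv_hom_whiskerRight {X Y : C} (e : X ≅ Y) (A : C) :
    e.inv ▷ₚ A ≫ e.hom ▷ₚ A = 𝟙 (Y ⅋ A) := by
  rw [← par_comp_whiskerRight, e.inv_hom_id, par_id_whiskerRight]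

theorem par_whiskerLeft_inv_hom (A : C) {X Y : C} (e : X ≅ Y) :
    A ◁ₚ e.inv ≫ A ◁ₚ e.hom = 𝟙 (A ⅋ Y) := by
  rw [← par_whiskerLeft_comp, e.inv_hom_id, par_whiskerLeft_id]

end ParLemmas

/-! ### Contracting with caps and inserting cups. -/

section Contraction

open LinDistrib

variable {C : Type u} [Category.{v} C] [MonoidalCategory C] [ParMonoidal C] [LinDistrib C]

theorem δL_natural_middle (A : C) {B B' : C} (g : B ⟶ B') (D : C) :
    A ◁ (g ▷ₚ D) ≫ δL A B' D = δL A B D ≫ (A ◁ g) ▷ₚ D := by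
  have e := δL_natural (𝟙 A) g (𝟙 D)
  have h1 : (g ⅋ₘ 𝟙 D) = g ▷ₚ D := @MonoidalCategory.tensorHom_id C _ ParMonoidal.mon _ _ g D
  rw [h1, MonoidalCategory.id_tensorHom, MonoidalCategory.id_tensorHom] at e
  exact e.trans (congrArg _ (@MonoidalCategory.tensorHom_id C _ ParMonoidal.mon _ _ _ D))

theorem δR_natural_middle (A : C) {B B' : C} (g : B ⟶ B') (D : C) :
    (A ◁ₚ g) ▷ D ≫ δR A B' D = δR A B D ≫ A ◁ₚ (g ▷ D) := by
  have e := δR_natural (𝟙 A) g (𝟙 D)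
  have h1 : (𝟙 A ⅋ₘ g) = A ◁ₚ g := @MonoidalCategory.id_tensorHom C _ ParMonoidal.mon A _ _ g
  rw [h1, MonoidalCategory.tensorHom_id, MonoidalCategory.tensorHom_id] at e
  exact e.trans (congrArg _ (@MonoidalCategory.id_tensorHom C _ ParMonoidal.mon A _ _ _))

/-- Contracting the two left factors of `A ⊗ (B ⊕ Z)` with a cap. -/
def contractL {A B : C} (ε : A ⊗ B ⟶ parUnit C) (Z : C) : A ⊗ (B ⅋ Z) ⟶ Z :=
  δL A B Z ≫ ε ▷ₚ Z ≫ (parLeftUnitor Z).hom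

/-- Contracting the two right factors of `(Z ⊕ A) ⊗ B` with a cap. -/
def contractR {A B : C} (ε : A ⊗ B ⟶ parUnit C) (Z : C) : (Z ⅋ A) ⊗ B ⟶ Z :=
  δR Z A B ≫ Z ◁ₚ ε ≫ (parRightUnitor Z).hom

/-- Inserting a cup on the left. -/
def expandL {A B : C} (η : 𝟙_ C ⟶ B ⅋ A) (X : C) : X ⟶ B ⅋ (A ⊗ X) :=
  (λ_ X).inv ≫ η ▷ X ≫ δR B A X

/-- Inserting a cup on the right. -/
def expandR {A B : C} (η : 𝟙_ C ⟶ B ⅋ A) (X : C) : X ⟶ (X ⊗ B) ⅋ A :=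
  (ρ_ X).inv ≫ X ◁ η ≫ δL X B A

theorem lcut_eq_expandL {A B X : C} (η : 𝟙_ C ⟶ B ⅋ A) (ε : A ⊗ X ⟶ parUnit C) :
    lcut η ε = expandL η X ≫ B ◁ₚ ε ≫ (parRightUnitor B).hom := by
  simp [lcut, expandL]

theorem rcut_eq_expandR {A B X : C} (η : 𝟙_ C ⟶ B ⅋ A) (ε : X ⊗ B ⟶ parUnit C) :
    rcut η ε = expandR η X ≫ ε ▷ₚ A ≫ (parLeftUnitor A).hom := by
  simp [rcut, expandR]

theorem lcut_eq_contractR {A B X : C} (η : 𝟙_ C ⟶ B ⅋ A) (ε : A ⊗ X ⟶ parUnit C) :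
    lcut η ε = (λ_ X).inv ≫ η ▷ X ≫ contractR ε B := rfl

theorem rcut_eq_contractL {A B X : C} (η : 𝟙_ C ⟶ B ⅋ A) (ε : X ⊗ B ⟶ parUnit C) :
    rcut η ε = (ρ_ X).inv ≫ X ◁ η ≫ contractL ε A := rfl

theorem contractL_naturality {A B : C} (ε : A ⊗ B ⟶ parUnit C) {Z Z' : C} (f : Z ⟶ Z') :
    A ◁ (B ◁ₚ f) ≫ contractL ε Z' = contractL ε Z ≫ f := by
  unfold contractL
  rw [reassoc_of% (δL_natural_right A B f), reassoc_of% (par_whisker_exchange ε f),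
    par_leftUnitor_naturality]
  simp only [Category.assoc]

theorem contractR_naturality {A B : C} (ε : A ⊗ B ⟶ parUnit C) {Z Z' : C} (f : Z ⟶ Z') :
    (f ▷ₚ A) ▷ B ≫ contractR ε Z' = contractR ε Z ≫ f := by
  unfold contractR
  rw [reassoc_of% (δR_natural_left f A B), ← reassoc_of% (par_whisker_exchange f ε),
    par_rightUnitor_naturality]
  simp only [Category.assoc]

theorem contractL_tensorHom {A B A' B' : C} (f : A' ⟶ A) (g : B' ⟶ B) (ε : A ⊗ B ⟶ parUnit C)
    (Z : C) : f ▷ (B' ⅋ Z) ≫ A ◁ (g ▷ₚ Z) ≫ contractL ε Z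
      = contractL (f ▷ B' ≫ A ◁ g ≫ ε) Z := by
  unfold contractL
  rw [reassoc_of% (δL_natural_middle A g Z), reassoc_of% (δL_natural_left f B' Z)]
  simp only [par_comp_whiskerRight, Category.assoc]

theorem contractR_tensorHom {A B A' B' : C} (f : A' ⟶ A) (g : B' ⟶ B) (ε : A ⊗ B ⟶ parUnit C)
    (Z : C) : (Z ◁ₚ f) ▷ B' ≫ (Z ⅋ A) ◁ g ≫ contractR ε Z
      = contractR (f ▷ B' ≫ A ◁ g ≫ ε) Z := by
  unfold contractR
  rw [reassoc_of% (δR_natural_right Z A g), reassoc_of% (δR_natural_middle Z f B')]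
  simp only [par_whiskerLeft_comp, Category.assoc]

/-- Joining a cup and two caps does not depend on the order. -/
theorem whiskerLeft_lcut_comp {A B X Y : C} (η : 𝟙_ C ⟶ B ⅋ A) (ε : Y ⊗ B ⟶ parUnit C)
    (e : A ⊗ X ⟶ parUnit C) : Y ◁ lcut η e ≫ ε = rcut η ε ▷ X ≫ e := by
  have h1 := par_rightUnitor_naturality ε
  unfold lcut rcut
  simp only [MonoidalCategory.whiskerLeft_comp, comp_whiskerRight, Category.assoc]
  rw [← δL_parUnit Y B, Category.assoc, reassoc_of% (δL_natural_right Y B e), ← h1,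
    reassoc_of% (par_whisker_exchange ε e), ← par_unitors_equal, par_leftUnitor_naturality e]
  have h8 : Y ◁ δR B A X ≫ δL Y B (A ⊗ X)
      = (α_ Y (B ⅋ A) X).inv ≫ δL Y B A ▷ X ≫ δR (Y ⊗ B) A X := by
    rw [δL_δR_tensor, Iso.inv_hom_id_assoc]
  rw [reassoc_of% h8, ← reassoc_of% (δR_natural_left ε A X), reassoc_of% (δR_parUnit A X)]
  have h9 : Y ◁ (λ_ X).inv ≫ Y ◁ η ▷ X ≫ (α_ Y (B ⅋ A) X).inv
      = (ρ_ Y).inv ▷ X ≫ (Y ◁ η) ▷ X := by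
    rw [associator_inv_naturality_middle]
    simp
  rw [reassoc_of% h9]

/-- Joining two cups and a cap does not depend on the order. -/
theorem comp_lcut_whiskerRight {A B A' B' : C} (η : 𝟙_ C ⟶ B ⅋ A) (η' : 𝟙_ C ⟶ B' ⅋ A')
    (e : A' ⊗ B ⟶ parUnit C) : η ≫ lcut η' e ▷ₚ A = η' ≫ B' ◁ₚ rcut η e := by
  have h1 : (λ_ B).inv ▷ₚ A = (λ_ (B ⅋ A)).inv ≫ δL (𝟙_ C) B A := by
    rw [Iso.eq_inv_comp, ← δL_tensorUnit B A, Category.assoc, par_hom_inv_whiskerRight,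
      Category.comp_id]
  have h2 : (ρ_ (B' ⅋ A')).inv ≫ δR B' A' (𝟙_ C) = B' ◁ₚ (ρ_ A').inv := by
    rw [Iso.inv_comp_eq, ← δR_tensorUnit B' A', Category.assoc, par_whiskerLeft_hom_inv,
      Category.comp_id]
  -- The mixed distributor law is what lets the two cups be evaluated in either order.
  have h3 := δL_δR_par B' A' B A
  rw [← Category.assoc, ← Iso.eq_comp_inv] at h3
  simp only [Category.assoc] at h3
  unfold lcut rcut
  simp only [par_whiskerLeft_comp, par_comp_whiskerRight, h1, Category.assoc]
  rw [← reassoc_of% (δL_natural_left η' B A), reassoc_of% h3,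
    ← reassoc_of% (par_associator_inv_naturality_middle B' e A), par_triangle_inv,
    ← reassoc_of% h2, ← reassoc_of% (δR_natural_right B' A' η)]
  -- Both sides are the juxtaposition of `η'` and `η`, since the two unitors of `⊤ ⊗ ⊤` agree.
  have h4 : η ≫ (λ_ (B ⅋ A)).inv ≫ η' ▷ (B ⅋ A)
      = η' ≫ (ρ_ (B' ⅋ A')).inv ≫ (B' ⅋ A') ◁ η := by
    rw [leftUnitor_inv_naturality_assoc, whisker_exchange, unitors_inv_equal,
      rightUnitor_inv_naturality_assoc]
  rw [reassoc_of% h4]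

/-- A cut performed beside a spectator `X`. With the cap under a par, `δL_δR_par` moves the
spectator out of the way. -/
theorem expandL_contractL {A B : C} (η : 𝟙_ C ⟶ B ⅋ A) {D : C} (ε : A ⊗ D ⟶ parUnit C) (X : C) :
    expandL η (D ⅋ X) ≫ B ◁ₚ contractL ε X = lcut η ε ▷ₚ X := by
  have h1 : (λ_ D).inv ▷ₚ X = (λ_ (D ⅋ X)).inv ≫ δL (𝟙_ C) D X := by
    rw [Iso.eq_inv_comp, ← δL_tensorUnit D X, Category.assoc, par_hom_inv_whiskerRight,
      Category.comp_id]
  have h3 := δL_δR_par B A D X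
  rw [← Category.assoc, ← Iso.eq_comp_inv] at h3
  simp only [Category.assoc] at h3
  unfold lcut expandL contractL
  simp only [par_whiskerLeft_comp, par_comp_whiskerRight, h1, Category.assoc]
  rw [← reassoc_of% (δL_natural_left η D X), reassoc_of% h3,
    ← reassoc_of% (par_associator_inv_naturality_middle B ε X), par_triangle_inv]

theorem expandR_contractR {A B : C} (η : 𝟙_ C ⟶ B ⅋ A) {D : C} (ε : D ⊗ B ⟶ parUnit C) (X : C) :
    expandR η (X ⅋ D) ≫ contractR ε X ▷ₚ A = X ◁ₚ rcut η ε := by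
  have h1 : X ◁ₚ (ρ_ D).inv = (ρ_ (X ⅋ D)).inv ≫ δR X D (𝟙_ C) := by
    rw [Iso.eq_inv_comp, ← δR_tensorUnit X D, Category.assoc, par_whiskerLeft_hom_inv,
      Category.comp_id]
  have h3 := δL_δR_par X D B A
  rw [← Category.assoc, ← Iso.eq_comp_inv] at h3
  simp only [Category.assoc] at h3
  unfold rcut expandR contractR
  simp only [par_whiskerLeft_comp, par_comp_whiskerRight, h1, Category.assoc]
  rw [reassoc_of% h3, ← reassoc_of% (par_associator_inv_naturality_middle X ε A),
    par_triangle_inv, ← reassoc_of% (δR_natural_right X D η)]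

/-- The same with a tensored spectator, where `δL_δR_tensor` takes over. -/
theorem whiskerLeft_expandL_contractL {A B Y : C} (η : 𝟙_ C ⟶ B ⅋ A) (ε : Y ⊗ B ⟶ parUnit C)
    (X : C) : Y ◁ expandL η X ≫ contractL ε (A ⊗ X) = rcut η ε ▷ X := by
  have h8 : Y ◁ δR B A X ≫ δL Y B (A ⊗ X)
      = (α_ Y (B ⅋ A) X).inv ≫ δL Y B A ▷ X ≫ δR (Y ⊗ B) A X := by
    rw [δL_δR_tensor, Iso.inv_hom_id_assoc]
  have h9 : Y ◁ (λ_ X).inv ≫ Y ◁ η ▷ X ≫ (α_ Y (B ⅋ A) X).inv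
      = (ρ_ Y).inv ▷ X ≫ (Y ◁ η) ▷ X := by
    rw [associator_inv_naturality_middle]
    simp
  unfold expandL contractL rcut
  simp only [MonoidalCategory.whiskerLeft_comp, comp_whiskerRight, Category.assoc]
  rw [reassoc_of% h8, ← reassoc_of% (δR_natural_left ε A X), δR_parUnit A X, reassoc_of% h9]

theorem expandR_whiskerRight_contractR {A B Y : C} (η : 𝟙_ C ⟶ B ⅋ A) (ε : A ⊗ Y ⟶ parUnit C)
    (X : C) : expandR η X ▷ Y ≫ contractR ε (X ⊗ B) = X ◁ lcut η ε := by
  have h9 : (ρ_ X).inv ▷ Y ≫ (X ◁ η) ▷ Y ≫ (α_ X (B ⅋ A) Y).hom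
      = X ◁ (λ_ Y).inv ≫ X ◁ η ▷ Y := by
    rw [associator_naturality_middle]
    simp
  unfold expandR contractR lcut
  simp only [MonoidalCategory.whiskerLeft_comp, comp_whiskerRight, Category.assoc]
  rw [reassoc_of% (δL_δR_tensor X B A Y), ← reassoc_of% (δL_natural_right X B ε),
    δL_parUnit X B, reassoc_of% h9]

theorem lcut_comp {A B B' X : C} (η : 𝟙_ C ⟶ B ⅋ A) (ε : A ⊗ X ⟶ parUnit C) (k : B ⟶ B') :
    lcut η ε ≫ k = lcut (η ≫ k ▷ₚ A) ε := by
  rw [lcut_eq_contractR, lcut_eq_contractR, comp_whiskerRight]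
  simp only [Category.assoc, contractR_naturality]

theorem rcut_comp {A A' B X : C} (η : 𝟙_ C ⟶ B ⅋ A) (ε : X ⊗ B ⟶ parUnit C) (k : A ⟶ A') :
    rcut η ε ≫ k = rcut (η ≫ B ◁ₚ k) ε := by
  rw [rcut_eq_contractL, rcut_eq_contractL, MonoidalCategory.whiskerLeft_comp]
  simp only [Category.assoc, contractL_naturality]

theorem lcut_whiskerLeft {A A' B X : C} (η : 𝟙_ C ⟶ B ⅋ A) (k : A ⟶ A')
    (ε : A' ⊗ X ⟶ parUnit C) : lcut (η ≫ B ◁ₚ k) ε = lcut η (k ▷ X ≫ ε) := by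
  unfold lcut
  simp only [comp_whiskerRight, par_whiskerLeft_comp, Category.assoc]
  rw [reassoc_of% (δR_natural_middle B k X)]

end Contraction

/-! ### Maps into linear duals are determined by their caps. -/

section LinearDualLemmas

open LinDistrib

variable {C : Type u} [Category.{v} C] [MonoidalCategory C] [ParMonoidal C] [LinDistrib C]

/-- The cap is nondegenerate: cutting `d.η` against the pairing of `f` returns `f`, by a snake
equation. This is the test by which the coherence laws below are proved. -/
theorem LinearDual.left_ext {A B X : C} (d : LinearDual B A) {f g : X ⟶ B}
    (h : A ◁ f ≫ d.ε = A ◁ g ≫ d.ε) : f = g := by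
  rw [← Category.comp_id f, ← Category.comp_id g, ← d.snake_left, comp_lcut, comp_lcut, h]

theorem LinearDual.right_ext {A B X : C} (d : LinearDual B A) {f g : X ⟶ A}
    (h : f ▷ B ≫ d.ε = g ▷ B ≫ d.ε) : f = g := by
  rw [← Category.comp_id f, ← Category.comp_id g, ← d.snake_right, comp_rcut, comp_rcut, h]

theorem LinearDual.lcut_comp_ε {A B X : C} (d : LinearDual B A) (k : X ⟶ B) :
    lcut d.η (A ◁ k ≫ d.ε) = k := by
  rw [← comp_lcut, d.snake_left, Category.comp_id]

theorem LinearDual.rcut_comp_ε {A B X : C} (d : LinearDual B A) (k : X ⟶ A) :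
    rcut d.η (k ▷ B ≫ d.ε) = k := by
  rw [← comp_rcut, d.snake_right, Category.comp_id]

/-- Maps that are mates for the caps are mates for the cups. -/
theorem LinearDual.η_mate {A B A' B' : C} (d : LinearDual B A) (d' : LinearDual B' A')
    {k : B ⟶ B'} {h : A' ⟶ A} (e : h ▷ B ≫ d.ε = A' ◁ k ≫ d'.ε) :
    d.η ≫ k ▷ₚ A = d'.η ≫ B' ◁ₚ h := by
  -- `k` is recovered from its pairing, which `e` rewrites as a pairing with `h`; exchanging the two
  -- cups then leaves `h`.
  rw [← d'.lcut_comp_ε k, ← e, comp_lcut_whiskerRight, d.rcut_comp_ε]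

theorem LinearDual.lmate_ε {A B A' B' : C} (d : LinearDual B A) (d' : LinearDual B' A')
    (f : A ⟶ A') : A ◁ d.lmate d' f ≫ d.ε = f ▷ B' ≫ d'.ε :=
  d.lcut_ε _

theorem LinearDual.rmate_ε {A B A' B' : C} (d : LinearDual B A) (d' : LinearDual B' A')
    (g : B ⟶ B') : d.rmate d' g ▷ B ≫ d.ε = A' ◁ g ≫ d'.ε :=
  d.rcut_ε _

/-- A cup and a cap which represent the caps on `A`, provided that `A` has some left dual. -/
def LinearDual.ofLeft {A B A' : C} (d : LinearDual A' A) (η : 𝟙_ C ⟶ B ⅋ A)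
    (ε : A ⊗ B ⟶ parUnit C) (h : lcut η ε = 𝟙 B)
    (h' : ∀ (X : C) (e : A ⊗ X ⟶ parUnit C), A ◁ lcut η e ≫ ε = e) : LinearDual B A where
  η := η
  ε := ε
  snake_left := h
  -- The second snake is tested against the cap of the known dual `d`, where `h'` applies to `d.ε`.
  snake_right := d.right_ext <| by rw [← whiskerLeft_lcut_comp, h', id_whiskerRight,
    Category.id_comp]

/-- A cup and a cap which represent the caps on `B`, provided that `B` has some right dual. -/
def LinearDual.ofRight {A B B' : C} (d : LinearDual B B') (η : 𝟙_ C ⟶ B ⅋ A)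
    (ε : A ⊗ B ⟶ parUnit C) (h : rcut η ε = 𝟙 A)
    (h' : ∀ (X : C) (e : X ⊗ B ⟶ parUnit C), rcut η e ▷ B ≫ ε = e) : LinearDual B A where
  η := η
  ε := ε
  snake_left := d.left_ext <| by rw [whiskerLeft_lcut_comp, h', MonoidalCategory.whiskerLeft_id,
    Category.id_comp]
  snake_right := h

end LinearDualLemmas

/-! ### Nested cups and caps: duals of tensors and pars. -/

section Nesting

open LinDistrib

variable {C : Type u} [Category.{v} C] [MonoidalCategory C] [ParMonoidal C] [LinDistrib C]

/-- Nesting the cap on `W, Z` inside the cap on `Y, X`, with caps grouped as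
`(Y ⊗ W) ⊗ (Z ⊕ X)`. -/
def nestCapPar {X Y Z W : C} (s : Y ⊗ X ⟶ parUnit C) (t : W ⊗ Z ⟶ parUnit C) :
    (Y ⊗ W) ⊗ (Z ⅋ X) ⟶ parUnit C :=
  (α_ Y W (Z ⅋ X)).hom ≫ Y ◁ contractL t X ≫ s

theorem nestCap_eq {X Y Z W : C} (s : Y ⊗ X ⟶ parUnit C) (t : W ⊗ Z ⟶ parUnit C) :
    nestCap s t = (α_ (Y ⅋ W) Z X).inv ≫ contractR t Y ▷ X ≫ s := rfl

theorem nestParTensor_eq {X Y Z W : C} (s : 𝟙_ C ⟶ X ⅋ Y) (t : 𝟙_ C ⟶ Z ⅋ W) :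
    nestParTensor s t = s ≫ X ◁ₚ expandL t Y ≫ (parAssoc X Z (W ⊗ Y)).inv := rfl

theorem nestTensorPar_eq {X Y Z W : C} (s : 𝟙_ C ⟶ X ⅋ Y) (t : 𝟙_ C ⟶ Z ⅋ W) :
    nestTensorPar s t = s ≫ expandR t X ▷ₚ Y ≫ (parAssoc (X ⊗ Z) W Y).hom := rfl

/-- Currying: the inner cup is cut first, with the outer one already in place, so `LinearDual.par`
can use the properties of the two cups separately. -/
theorem lcut_nestParTensor {A B A' B' X : C} (s : 𝟙_ C ⟶ B ⅋ A) (t : 𝟙_ C ⟶ B' ⅋ A')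
    (e : (A' ⊗ A) ⊗ X ⟶ parUnit C) :
    lcut (nestParTensor s t) e = expandL s X ≫ B ◁ₚ lcut t ((α_ A' A X).inv ≫ e) := by
  have h1 := δR_parAssoc B B' (A' ⊗ A) X
  rw [← Iso.comp_inv_eq] at h1
  have h2 : (parAssoc B B' (A' ⊗ A)).inv ▷ X ≫ δR (B ⅋ B') (A' ⊗ A) X
      = δR B (B' ⅋ (A' ⊗ A)) X ≫ B ◁ₚ δR B' (A' ⊗ A) X
        ≫ (parAssoc B B' ((A' ⊗ A) ⊗ X)).inv := by
    simp only [Category.assoc] at h1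
    rw [← h1, ← comp_whiskerRight_assoc, Iso.inv_hom_id, id_whiskerRight, Category.id_comp]
  have h3 : expandL t A ▷ X ≫ δR B' (A' ⊗ A) X
      = (λ_ (A ⊗ X)).inv ≫ t ▷ (A ⊗ X) ≫ δR B' A' (A ⊗ X) ≫ B' ◁ₚ (α_ A' A X).inv := by
    have h4 := δR_tensorAssoc B' A' A X
    have h5 : δR B' A' A ▷ X ≫ δR B' (A' ⊗ A) X
        = (α_ (B' ⅋ A') A X).hom ≫ δR B' A' (A ⊗ X) ≫ B' ◁ₚ (α_ A' A X).inv := by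
      rw [← reassoc_of% h4, par_whiskerLeft_hom_inv, Category.comp_id]
    unfold expandL
    simp only [comp_whiskerRight, Category.assoc]
    rw [h5]
    simp
  have h6 : (parAssoc B B' ((A' ⊗ A) ⊗ X)).inv ≫ (B ⅋ B') ◁ₚ e
        ≫ (parRightUnitor (B ⅋ B')).hom
      = B ◁ₚ (B' ◁ₚ e ≫ (parRightUnitor B').hom) := by
    rw [par_rightUnitor_tensor, reassoc_of% (par_associator_naturality_right B B' e),
      Iso.inv_hom_id_assoc, par_whiskerLeft_comp]
  unfold lcut
  rw [nestParTensor_eq]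
  simp only [comp_whiskerRight, Category.assoc]
  rw [reassoc_of% h2, reassoc_of% (δR_natural_middle B (expandL t A) X), h6]
  simp only [← par_whiskerLeft_comp]
  rw [reassoc_of% h3]
  simp only [expandL, par_whiskerLeft_comp, Category.assoc]

theorem rcut_nestTensorPar {A B A' B' X : C} (s : 𝟙_ C ⟶ B ⅋ A) (t : 𝟙_ C ⟶ B' ⅋ A')
    (e : X ⊗ (B ⊗ B') ⟶ parUnit C) :
    rcut (nestTensorPar s t) e = expandR s X ≫ rcut t ((α_ X B B').hom ≫ e) ▷ₚ A := by
  have h1 := δL_parAssoc X (B ⊗ B') A' A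
  have h2 : X ◁ (parAssoc (B ⊗ B') A' A).hom ≫ δL X (B ⊗ B') (A' ⅋ A)
      = δL X ((B ⊗ B') ⅋ A') A ≫ δL X (B ⊗ B') A' ▷ₚ A
        ≫ (parAssoc (X ⊗ (B ⊗ B')) A' A).hom := h1.symm
  have h3 : X ◁ expandR t B ≫ δL X (B ⊗ B') A'
      = (ρ_ (X ⊗ B)).inv ≫ (X ⊗ B) ◁ t ≫ δL (X ⊗ B) B' A' ≫ (α_ X B B').hom ▷ₚ A' := by
    have h5 : X ◁ δL B B' A' ≫ δL X (B ⊗ B') A'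
        = (α_ X B (B' ⅋ A')).inv ≫ δL (X ⊗ B) B' A' ≫ (α_ X B B').hom ▷ₚ A' := by
      rw [← δL_tensorAssoc, Iso.inv_hom_id_assoc]
    unfold expandR
    simp only [MonoidalCategory.whiskerLeft_comp, Category.assoc]
    rw [h5]
    simp
  have h6 : (parAssoc (X ⊗ (B ⊗ B')) A' A).hom ≫ e ▷ₚ (A' ⅋ A)
        ≫ (parLeftUnitor (A' ⅋ A)).hom
      = (e ▷ₚ A' ≫ (parLeftUnitor A').hom) ▷ₚ A := by
    rw [par_leftUnitor_tensor, reassoc_of% (par_associator_inv_naturality_left e A' A),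
      Iso.hom_inv_id_assoc, par_comp_whiskerRight]
  unfold rcut
  rw [nestTensorPar_eq]
  simp only [MonoidalCategory.whiskerLeft_comp, Category.assoc]
  rw [reassoc_of% h2, reassoc_of% (δL_natural_middle X (expandR t B) A), h6]
  simp only [← par_comp_whiskerRight]
  rw [reassoc_of% h3]
  simp only [expandR, par_comp_whiskerRight, Category.assoc]

/-- The par of left duals is a left dual of the tensor. -/
def LinearDual.par [StarAutonomous C] {A B A' B' : C} (d : LinearDual B A)
    (d' : LinearDual B' A') : LinearDual (B ⅋ B') (A' ⊗ A) :=
  (StarAutonomous.ldual (A' ⊗ A)).ofLeft (nestParTensor d.η d'.η) (nestCapPar d'.ε d.ε)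
    (by
      rw [lcut_nestParTensor, nestCapPar, Iso.inv_hom_id_assoc, d'.lcut_comp_ε,
        expandL_contractL, d.snake_left, par_id_whiskerRight])
    (fun X e => by
      rw [lcut_nestParTensor, nestCapPar, associator_naturality_right_assoc,
        ← MonoidalCategory.whiskerLeft_comp_assoc, MonoidalCategory.whiskerLeft_comp A,
        Category.assoc, contractL_naturality, reassoc_of% (whiskerLeft_expandL_contractL d.η d.ε),
        d.snake_right, id_whiskerRight, Category.id_comp, d'.lcut_ε, Iso.hom_inv_id_assoc])

/-- The tensor of left duals is a left dual of the par. -/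
def LinearDual.tensor [StarAutonomous C] {A B A' B' : C} (d : LinearDual B A)
    (d' : LinearDual B' A') : LinearDual (B ⊗ B') (A' ⅋ A) :=
  -- `nestTensorPar` is built from `expandR`, so it is `rcut` that unfolds along it; hence the
  -- criterion on the right.
  (StarAutonomous.rdual (B ⊗ B')).ofRight (nestTensorPar d.η d'.η) (nestCap d'.ε d.ε)
    (by
      rw [rcut_nestTensorPar, nestCap_eq, Iso.hom_inv_id_assoc, d'.rcut_comp_ε,
        expandR_contractR, d.snake_right, par_whiskerLeft_id])
    (fun X e => by
      rw [rcut_nestTensorPar, nestCap_eq, associator_inv_naturality_left_assoc,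
        ← comp_whiskerRight_assoc, comp_whiskerRight _ _ B,
        Category.assoc, contractR_naturality,
        reassoc_of% (expandR_whiskerRight_contractR d.η d.ε),
        d.snake_left, MonoidalCategory.whiskerLeft_id, Category.id_comp, d'.rcut_ε,
        Iso.inv_hom_id_assoc])

/-- Maps on the four legs can be moved into the two caps separately; later comparisons of nested
caps rely on this. -/
theorem nestCapPar_tensorHom {X Y Z W X' Y' Z' W' : C} (s : Y ⊗ X ⟶ parUnit C)
    (t : W ⊗ Z ⟶ parUnit C) (x : X' ⟶ X) (y : Y' ⟶ Y) (z : Z' ⟶ Z) (w : W' ⟶ W) :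
    (y ⊗ₘ w) ▷ (Z' ⅋ X') ≫ (Y ⊗ W) ◁ (z ⅋ₘ x) ≫ nestCapPar s t
      = nestCapPar (y ▷ X' ≫ Y ◁ x ≫ s) (w ▷ Z' ≫ W ◁ z ≫ t) := by
  unfold nestCapPar
  rw [← contractL_tensorHom, par_tensorHom_def, MonoidalCategory.tensorHom_def]
  have h1 := contractL_naturality t x
  rw [associator_naturality_right_assoc, comp_whiskerRight, Category.assoc,
    ← MonoidalCategory.whiskerLeft_comp_assoc, MonoidalCategory.whiskerLeft_comp W,
    Category.assoc, h1]
  simp only [MonoidalCategory.whiskerLeft_comp, Category.assoc, associator_naturality_left_assoc,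
    associator_naturality_middle_assoc, whisker_exchange_assoc]

theorem nestCap_tensorHom {X Y Z W X' Y' Z' W' : C} (s : Y ⊗ X ⟶ parUnit C)
    (t : W ⊗ Z ⟶ parUnit C) (x : X' ⟶ X) (y : Y' ⟶ Y) (z : Z' ⟶ Z) (w : W' ⟶ W) :
    (y ⅋ₘ w) ▷ (Z' ⊗ X') ≫ (Y ⅋ W) ◁ (z ⊗ₘ x) ≫ nestCap s t
      = nestCap (y ▷ X' ≫ Y ◁ x ≫ s) (w ▷ Z' ≫ W ◁ z ≫ t) := by
  have h1 := contractR_naturality t y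
  -- This order of whiskering puts `y` next to `contractR t`, past which it moves by naturality.
  have h2 : (y ⅋ₘ w) = Y' ◁ₚ w ≫ y ▷ₚ W := by rw [par_tensorHom_def, par_whisker_exchange]
  rw [nestCap_eq, nestCap_eq, ← contractR_tensorHom, h2, tensorHom_def',
    ← whisker_exchange_assoc, associator_inv_naturality_left_assoc, ← comp_whiskerRight_assoc,
    comp_whiskerRight _ _ Z, Category.assoc, h1]
  simp only [MonoidalCategory.whiskerLeft_comp, comp_whiskerRight, Category.assoc,
    associator_inv_naturality_right_assoc, associator_inv_naturality_middle_assoc,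
    ← whisker_exchange_assoc]

end Nesting

/-! ### Regrouping three concentric caps. -/

section NestingCoherence

open LinDistrib

variable {C : Type u} [Category.{v} C] [MonoidalCategory C] [ParMonoidal C] [LinDistrib C]

theorem δR_tensorAssoc_inv (A B D E : C) :
    δR A B (D ⊗ E) ≫ A ◁ₚ (α_ B D E).inv
      = (α_ (A ⅋ B) D E).inv ≫ δR A B D ▷ E ≫ δR A (B ⊗ D) E := by
  rw [Iso.eq_inv_comp, ← reassoc_of% (δR_tensorAssoc A B D E), par_whiskerLeft_hom_inv,
    Category.comp_id]

theorem δL_tensorAssoc_inv (A B D E : C) :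
    A ◁ δL B D E ≫ δL A (B ⊗ D) E
      = (α_ A B (D ⅋ E)).inv ≫ δL (A ⊗ B) D E ≫ (α_ A B D).hom ▷ₚ E := by
  rw [Iso.eq_inv_comp, δL_tensorAssoc]

theorem contractR_par {A B : C} (t : A ⊗ B ⟶ parUnit C) (X Y : C) :
    (parAssoc X Y A).hom ▷ B ≫ δR X (Y ⅋ A) B ≫ X ◁ₚ contractR t Y = contractR t (X ⅋ Y) := by
  unfold contractR
  simp only [par_whiskerLeft_comp]
  rw [reassoc_of% (δR_parAssoc X Y A B), par_rightUnitor_tensor,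
    reassoc_of% (par_associator_naturality_right X Y t)]

theorem contractL_par {A B : C} (t : A ⊗ B ⟶ parUnit C) (X Y : C) :
    A ◁ (parAssoc B X Y).hom ≫ contractL t (X ⅋ Y) = δL A (B ⅋ X) Y ≫ contractL t X ▷ₚ Y := by
  unfold contractL
  simp only [par_comp_whiskerRight]
  rw [← reassoc_of% (δL_parAssoc A B X Y), par_leftUnitor_tensor,
    ← reassoc_of% (par_associator_naturality_left t X Y), Iso.hom_inv_id_assoc]

/-- Contraction along a nested cap beside a spectator `A` is two successive contractions, the inner
pair first. -/
theorem contractR_nestCap {X Y Z W : C} (s : Y ⊗ X ⟶ parUnit C) (t : W ⊗ Z ⟶ parUnit C) (A : C) :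
    (parAssoc A Y W).hom ▷ (Z ⊗ X) ≫ contractR (nestCap s t) A
      = (α_ ((A ⅋ Y) ⅋ W) Z X).inv ≫ contractR t (A ⅋ Y) ▷ X ≫ contractR s A := by
  rw [nestCap_eq, ← contractR_par t A Y]
  unfold contractR
  simp only [par_whiskerLeft_comp, comp_whiskerRight, Category.assoc]
  rw [reassoc_of% (δR_tensorAssoc_inv A (Y ⅋ W) Z X),
    ← reassoc_of% (δR_natural_middle A (δR Y W Z) X),
    ← reassoc_of% (δR_natural_middle A (Y ◁ₚ t) X),
    ← reassoc_of% (δR_natural_middle A (parRightUnitor Y).hom X), associator_inv_naturality_left_assoc]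

theorem contractL_nestCapPar {X Y Z W : C} (s : Y ⊗ X ⟶ parUnit C) (t : W ⊗ Z ⟶ parUnit C)
    (A : C) : contractL (nestCapPar s t) A
      = (Y ⊗ W) ◁ (parAssoc Z X A).hom ≫ (α_ Y W (Z ⅋ (X ⅋ A))).hom
        ≫ Y ◁ contractL t (X ⅋ A) ≫ contractL s A := by
  rw [associator_naturality_right_assoc, ← MonoidalCategory.whiskerLeft_comp_assoc,
    contractL_par t X A, nestCapPar]
  unfold contractL
  simp only [par_comp_whiskerRight, MonoidalCategory.whiskerLeft_comp, Category.assoc]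
  rw [← reassoc_of% (δL_tensorAssoc Y W (Z ⅋ X) A),
    ← reassoc_of% (δL_natural_middle Y (δL W Z X) A),
    ← reassoc_of% (δL_natural_middle Y (t ▷ₚ X) A),
    ← reassoc_of% (δL_natural_middle Y (parLeftUnitor X).hom A)]

/-- Either grouping contracts `D` with `D'`, then `B` with `B'`, then `A` with `A'`. -/
theorem nestCap_assoc {A A' B B' D D' : C} (r : A ⊗ A' ⟶ parUnit C) (s : B ⊗ B' ⟶ parUnit C)
    (t : D ⊗ D' ⟶ parUnit C) :
    (parAssoc A B D).hom ▷ (D' ⊗ (B' ⊗ A')) ≫ (A ⅋ (B ⅋ D)) ◁ (α_ D' B' A').inv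
        ≫ nestCap r (nestCap s t)
      = nestCap (nestCap r s) t := by
  rw [nestCap_eq r (nestCap s t), ← whisker_exchange_assoc, associator_inv_naturality_left_assoc,
    ← comp_whiskerRight_assoc, contractR_nestCap, nestCap_eq, nestCap_eq r s]
  simp

theorem nestCapPar_assoc {A A' B B' D D' : C} (r : A ⊗ A' ⟶ parUnit C)
    (s : B ⊗ B' ⟶ parUnit C) (t : D ⊗ D' ⟶ parUnit C) :
    (α_ A B D).hom ▷ (D' ⅋ (B' ⅋ A')) ≫ (A ⊗ (B ⊗ D)) ◁ (parAssoc D' B' A').inv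
        ≫ nestCapPar r (nestCapPar s t)
      = nestCapPar (nestCapPar r s) t := by
  rw [nestCapPar, contractL_nestCapPar, nestCapPar, nestCapPar,
    associator_naturality_right_assoc, ← MonoidalCategory.whiskerLeft_comp_assoc,
    MonoidalCategory.tensor_whiskerLeft]
  simp

theorem whiskerLeft_δL_contractL_nestCap {X Y Z W : C} (s : Y ⊗ X ⟶ parUnit C)
    (t : W ⊗ Z ⟶ parUnit C) (A : C) :
    (Y ⅋ W) ◁ δL Z X A ≫ contractL (nestCap s t) A
      = (α_ (Y ⅋ W) Z (X ⅋ A)).inv ≫ contractR t Y ▷ (X ⅋ A) ≫ contractL s A := by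
  rw [nestCap_eq]
  unfold contractL
  simp only [par_comp_whiskerRight, Category.assoc]
  rw [reassoc_of% (δL_tensorAssoc_inv (Y ⅋ W) Z X A),
    reassoc_of% (par_hom_inv_whiskerRight (α_ (Y ⅋ W) Z X) A),
    ← reassoc_of% (δL_natural_left (contractR t Y) X A)]

theorem δL_whiskerRight_contractR {A B : C} (t : A ⊗ B ⟶ parUnit C) (X Y : C) :
    δL X Y A ▷ B ≫ contractR t (X ⊗ Y) = (α_ X (Y ⅋ A) B).hom ≫ X ◁ contractR t Y := by
  unfold contractR
  rw [reassoc_of% (δL_δR_tensor X Y A B), ← reassoc_of% (δL_natural_right X Y t), δL_parUnit]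
  simp only [MonoidalCategory.whiskerLeft_comp]

theorem whiskerLeft_δR_contractL {A B : C} (t : A ⊗ B ⟶ parUnit C) (X Y : C) :
    A ◁ δR B X Y ≫ contractL t (X ⊗ Y) = (α_ A (B ⅋ X) Y).inv ≫ contractL t X ▷ Y := by
  have h := δL_δR_tensor A B X Y
  rw [← Iso.inv_comp_eq] at h
  unfold contractL
  rw [← reassoc_of% h, ← reassoc_of% (δR_natural_left t X Y), δR_parUnit]
  simp only [comp_whiskerRight]

theorem δR_whiskerRight_contractR_nestCapPar {X Y Z W : C} (s : Y ⊗ X ⟶ parUnit C)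
    (t : W ⊗ Z ⟶ parUnit C) (A : C) :
    δR A Y W ▷ (Z ⅋ X) ≫ contractR (nestCapPar s t) A
      = (α_ (A ⅋ Y) W (Z ⅋ X)).hom ≫ (A ⅋ Y) ◁ contractL t X ≫ contractR s A := by
  rw [nestCapPar]
  unfold contractR
  simp only [par_whiskerLeft_comp, Category.assoc]
  rw [reassoc_of% (δR_tensorAssoc A Y W (Z ⅋ X)),
    ← reassoc_of% (δR_natural_right A Y (contractL t X))]

/-- Both sides contract `A` with `A'`, then `B` with `B'`, then `D` with `D'`; the distributors only
change the grouping of the legs. -/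
theorem nestCapPar_nestCap_δL {A A' B B' D D' : C} (r : D ⊗ D' ⟶ parUnit C)
    (s : B ⊗ B' ⟶ parUnit C) (t : A ⊗ A' ⟶ parUnit C) :
    (D ⊗ (B ⅋ A)) ◁ δL A' B' D' ≫ nestCapPar r (nestCap s t)
      = δL D B A ▷ (A' ⊗ (B' ⅋ D')) ≫ nestCap (nestCapPar r s) t := by
  rw [nestCapPar, associator_naturality_right_assoc, ← MonoidalCategory.whiskerLeft_comp_assoc,
    whiskerLeft_δL_contractL_nestCap, nestCap_eq, associator_inv_naturality_left_assoc,
    ← comp_whiskerRight_assoc, δL_whiskerRight_contractR, nestCapPar]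
  simp

theorem nestCapPar_nestCap_δR {A A' B B' D D' : C} (r : D ⊗ D' ⟶ parUnit C)
    (s : B ⊗ B' ⟶ parUnit C) (t : A ⊗ A' ⟶ parUnit C) :
    ((D ⅋ B) ⊗ A) ◁ δR A' B' D' ≫ nestCapPar (nestCap r s) t
      = δR D B A ▷ ((A' ⅋ B') ⊗ D') ≫ nestCap r (nestCapPar s t) := by
  rw [nestCapPar, associator_naturality_right_assoc, ← MonoidalCategory.whiskerLeft_comp_assoc,
    whiskerLeft_δR_contractL, nestCap_eq r (nestCapPar s t),
    associator_inv_naturality_left_assoc,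
    ← comp_whiskerRight_assoc, δR_whiskerRight_contractR_nestCapPar, nestCap_eq]
  simp

end NestingCoherence

/-! ### The dagger exchanges cups and caps. -/

section DaggerCaps

open LinDistrib DaggerLDC

variable {C : Type u} [Category.{v} C] [MonoidalCategory C] [ParMonoidal C] [LinDistrib C]
  [DaggerLDC C]

theorem dgMap_comp {X Y Z : C} (f : X ⟶ Y) (g : Y ⟶ Z) : dgMap (f ≫ g) = dgMap g ≫ dgMap f := by
  simp [dgMap]

theorem dgMap_id (X : C) : dgMap (𝟙 X) = 𝟙 (dg X) := by
  simp [dgMap]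

theorem involutor_naturality {X Y : C} (f : X ⟶ Y) :
    f ≫ involutor Y = involutor X ≫ dgMap (dgMap f) :=
  DaggerLDC.ι.hom.naturality f

theorem involutorInv_naturality {X Y : C} (f : X ⟶ Y) :
    dgMap (dgMap f) ≫ involutorInv Y = involutorInv X ≫ f :=
  DaggerLDC.ι.inv.naturality f

theorem involutor_involutorInv (X : C) : involutor X ≫ involutorInv X = 𝟙 X :=
  DaggerLDC.ι.hom_inv_id_app X

theorem involutorInv_involutor (X : C) : involutorInv X ≫ involutor X = 𝟙 (dg (dg X)) :=
  DaggerLDC.ι.inv_hom_id_app X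

theorem dgMap_involutorInv (A : C) : dgMap (involutorInv A) = involutor (dg A) :=
  (DaggerLDC.ι_dag A).symm

instance (X : C) : IsIso (involutorInv X) :=
  inferInstanceAs (IsIso (DaggerLDC.ι.inv.app X))

theorem lamT_natural_left {A A' : C} (f : A ⟶ A') (B : C) :
    dgMap f ▷ dg B ≫ (lamT A B).hom = (lamT A' B).hom ≫ dgMap (f ▷ₚ B) := by
  have h := lamT_natural f (𝟙 B)
  have h1 : (f ⅋ₘ 𝟙 B) = f ▷ₚ B := @MonoidalCategory.tensorHom_id C _ ParMonoidal.mon _ _ f B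
  rwa [h1, op_id, CategoryTheory.Functor.map_id, MonoidalCategory.tensorHom_id] at h

theorem lamT_natural_right (A : C) {B B' : C} (f : B ⟶ B') :
    dg A ◁ dgMap f ≫ (lamT A B).hom = (lamT A B').hom ≫ dgMap (A ◁ₚ f) := by
  have h := lamT_natural (𝟙 A) f
  have h1 : (𝟙 A ⅋ₘ f) = A ◁ₚ f := @MonoidalCategory.id_tensorHom C _ ParMonoidal.mon A _ _ f
  rwa [h1, op_id, CategoryTheory.Functor.map_id, MonoidalCategory.id_tensorHom] at h

theorem lamP_natural_left {A A' : C} (f : A ⟶ A') (B : C) :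
    dgMap f ▷ₚ dg B ≫ (lamP A B).hom = (lamP A' B).hom ≫ dgMap (f ▷ B) := by
  have h := lamP_natural f (𝟙 B)
  rw [op_id, CategoryTheory.Functor.map_id, MonoidalCategory.tensorHom_id] at h
  have h1 : (dgMap f ⅋ₘ 𝟙 (dg B)) = dgMap f ▷ₚ dg B :=
    @MonoidalCategory.tensorHom_id C _ ParMonoidal.mon _ _ _ _
  exact h1 ▸ h

theorem lamP_natural_right (A : C) {B B' : C} (f : B ⟶ B') :
    dg A ◁ₚ dgMap f ≫ (lamP A B).hom = (lamP A B').hom ≫ dgMap (A ◁ f) := by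
  have h := lamP_natural (𝟙 A) f
  rw [op_id, CategoryTheory.Functor.map_id, MonoidalCategory.id_tensorHom] at h
  have h1 : (𝟙 (dg A) ⅋ₘ dgMap f) = dg A ◁ₚ dgMap f :=
    @MonoidalCategory.id_tensorHom C _ ParMonoidal.mon _ _ _ _
  exact h1 ▸ h

/-- The dagger of a cup `⊤ ⟶ X ⊕ Y`, as a cap `X^† ⊗ Y^† ⟶ ⊥`. -/
def dagCap {X Y : C} (η : 𝟙_ C ⟶ X ⅋ Y) : dg X ⊗ dg Y ⟶ parUnit C :=
  (lamT X Y).hom ≫ dgMap η ≫ lamBot.inv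

theorem dagCup_whiskerRight {X X' Y : C} (f : X' ⟶ X) (ε : X ⊗ Y ⟶ parUnit C) :
    dagCup (f ▷ Y ≫ ε) = dagCup ε ≫ dgMap f ▷ₚ dg Y := by
  unfold dagCup
  have h := lamP_natural_left f Y
  rw [← Iso.inv_comp_eq, ← Category.assoc, ← Iso.eq_comp_inv] at h
  rw [dgMap_comp, Category.assoc, ← h]
  simp only [Category.assoc]

theorem dagCap_whiskerLeft {X Y Y' : C} (η : 𝟙_ C ⟶ X ⅋ Y) (f : Y ⟶ Y') :
    dagCap (η ≫ X ◁ₚ f) = dg X ◁ dgMap f ≫ dagCap η := by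
  unfold dagCap
  rw [dgMap_comp, reassoc_of% (lamT_natural_right X f), Category.assoc]

theorem dagCap_whiskerRight {X X' Y : C} (η : 𝟙_ C ⟶ X ⅋ Y) (f : X ⟶ X') :
    dagCap (η ≫ f ▷ₚ Y) = dgMap f ▷ dg Y ≫ dagCap η := by
  unfold dagCap
  rw [dgMap_comp, reassoc_of% (lamT_natural_left f Y), Category.assoc]

/-- Naturality of `ι` at `ε`, with `ι_tensor` and `ι_parUnit` absorbing the laxors: two daggers give
the cap back. -/
theorem involutor_dagCap_dagCup {X Y : C} (ε : X ⊗ Y ⟶ parUnit C) :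
    (involutor X ⊗ₘ involutor Y) ≫ dagCap (dagCup ε) = ε := by
  unfold dagCap dagCup
  simp only [dgMap_comp, Category.assoc]
  rw [← reassoc_of% (ι_tensor X Y), ← reassoc_of% (dgMap_comp (lamP X Y).inv (lamP X Y).hom),
    Iso.inv_hom_id, dgMap_id, Category.id_comp, ← reassoc_of% (involutor_naturality ε),
    reassoc_of% (ι_parUnit (C := C)), Iso.hom_inv_id, Category.comp_id]

/-- The dagger reverses the insertion of a cup into a contraction; `lam_δR` matches the
distributors, `lamP_right` the unitors. -/
theorem contractR_dagCap {A B : C} (η : 𝟙_ C ⟶ B ⅋ A) (X : C) :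
    contractR (dagCap η) (dg X)
      = (lamP X B).hom ▷ dg A ≫ (lamT (X ⊗ B) A).hom ≫ dgMap (expandR η X) := by
  have h1 : dg X ◁ₚ lamBot.inv ≫ (parRightUnitor (dg X)).hom
      = (lamP X (𝟙_ C)).hom ≫ dgMap (ρ_ X).inv := by
    have h : (parRightUnitor (dg X)).hom
        = dg X ◁ₚ lamBot.hom ≫ (lamP X (𝟙_ C)).hom ≫ dgMap (ρ_ X).inv := by
      rw [reassoc_of% (lamP_right X), ← dgMap_comp, Iso.inv_hom_id, dgMap_id, Category.comp_id]
    rw [h, reassoc_of% (par_whiskerLeft_inv_hom (dg X) lamBot)]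
  unfold contractR dagCap expandR
  simp only [par_whiskerLeft_comp, dgMap_comp, Category.assoc]
  rw [h1, reassoc_of% (lamP_natural_right X η), reassoc_of% (lam_δR X B A)]

theorem contractL_dagCap {A B : C} (η : 𝟙_ C ⟶ B ⅋ A) (X : C) :
    contractL (dagCap η) (dg X)
      = dg B ◁ (lamP A X).hom ≫ (lamT B (A ⊗ X)).hom ≫ dgMap (expandL η X) := by
  have h1 : lamBot.inv ▷ₚ dg X ≫ (parLeftUnitor (dg X)).hom
      = (lamP (𝟙_ C) X).hom ≫ dgMap (λ_ X).inv := by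
    have h : (parLeftUnitor (dg X)).hom
        = lamBot.hom ▷ₚ dg X ≫ (lamP (𝟙_ C) X).hom ≫ dgMap (λ_ X).inv := by
      rw [reassoc_of% (lamP_left X), ← dgMap_comp, Iso.inv_hom_id, dgMap_id, Category.comp_id]
    rw [h, reassoc_of% (par_inv_hom_whiskerRight lamBot (dg X))]
  unfold contractL dagCap expandL
  simp only [par_comp_whiskerRight, dgMap_comp, Category.assoc]
  rw [h1, reassoc_of% (lamP_natural_left η X), reassoc_of% (lam_δL B A X)]

/-- The dagger interchanges the two kinds of cut, and with them the two snake equations, so it sends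
linear duals to linear duals. -/
theorem lcut_dagCup_dagCap {A B X : C} (η : 𝟙_ C ⟶ B ⅋ A) (ε : X ⊗ B ⟶ parUnit C) :
    lcut (dagCup ε) (dagCap η) = dgMap (rcut η ε) := by
  rw [lcut_eq_contractR, contractR_dagCap, rcut_eq_expandR]
  unfold dagCup
  simp only [dgMap_comp, comp_whiskerRight, Category.assoc, inv_hom_whiskerRight_assoc]
  rw [reassoc_of% (lamT_natural_left ε A), reassoc_of% (lamT_left A), Iso.inv_hom_id_assoc]

theorem rcut_dagCup_dagCap {A B X : C} (η : 𝟙_ C ⟶ B ⅋ A) (ε : A ⊗ X ⟶ parUnit C) :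
    rcut (dagCup ε) (dagCap η) = dgMap (lcut η ε) := by
  rw [rcut_eq_contractL, contractL_dagCap, lcut_eq_expandL]
  unfold dagCup
  simp only [dgMap_comp, MonoidalCategory.whiskerLeft_comp, Category.assoc,
    whiskerLeft_inv_hom_assoc]
  rw [reassoc_of% (lamT_natural_right B ε), reassoc_of% (lamT_right B), Iso.inv_hom_id_assoc]

/-- The dagger of a linear dual. -/
def LinearDual.dagger {A B : C} (d : LinearDual B A) : LinearDual (dg A) (dg B) where
  η := dagCup d.ε
  ε := dagCap d.η
  snake_left := by rw [lcut_dagCup_dagCap, d.snake_right, dgMap_id]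
  snake_right := by rw [rcut_dagCup_dagCap, d.snake_left, dgMap_id]

theorem dagCap_nestTensorPar {X Y Z W : C} (s : 𝟙_ C ⟶ X ⅋ Y) (t : 𝟙_ C ⟶ Z ⅋ W) :
    (lamP X Z).hom ▷ (dg W ⊗ dg Y) ≫ dg (X ⊗ Z) ◁ (lamT W Y).hom ≫ dagCap (nestTensorPar s t)
      = nestCap (dagCap s) (dagCap t) := by
  rw [nestCap_eq, contractR_dagCap, nestTensorPar_eq]
  unfold dagCap
  simp only [dgMap_comp, comp_whiskerRight, Category.assoc]
  rw [reassoc_of% (lamT_natural_left (expandR t X) Y), ← associator_inv_naturality_left_assoc,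
    reassoc_of% (lamT_assoc (X ⊗ Z) W Y)]

theorem dagCap_nestParTensor {X Y Z W : C} (s : 𝟙_ C ⟶ X ⅋ Y) (t : 𝟙_ C ⟶ Z ⅋ W) :
    (lamT X Z).hom ▷ (dg W ⅋ dg Y) ≫ dg (X ⅋ Z) ◁ (lamP W Y).hom ≫ dagCap (nestParTensor s t)
      = nestCapPar (dagCap s) (dagCap t) := by
  have h : (lamT X Z).hom ▷ dg (W ⊗ Y) ≫ (lamT (X ⅋ Z) (W ⊗ Y)).hom
        ≫ dgMap (parAssoc X Z (W ⊗ Y)).inv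
      = (α_ (dg X) (dg Z) (dg (W ⊗ Y))).hom ≫ dg X ◁ (lamT Z (W ⊗ Y)).hom
        ≫ (lamT X (Z ⅋ (W ⊗ Y))).hom := by
    rw [← Iso.inv_comp_eq, reassoc_of% (lamT_assoc X Z (W ⊗ Y)), ← dgMap_comp, Iso.inv_hom_id,
      dgMap_id, Category.comp_id]
  rw [nestCapPar, contractL_dagCap, nestParTensor_eq]
  unfold dagCap
  simp only [dgMap_comp, MonoidalCategory.whiskerLeft_comp, Category.assoc]
  rw [reassoc_of% (lamT_natural_right X (expandL t Y)), ← associator_naturality_right_assoc,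
    ← whisker_exchange_assoc, reassoc_of% h]

end DaggerCaps

/-! ### Uniqueness of left duals. -/

section LeftUnique

variable {C : Type u} [Category.{v} C] [MonoidalCategory C] [ParMonoidal C] [LinDistrib C]

/-- Two left duals of the same object are isomorphic. -/
@[simps]
def LinearDual.leftUnique {A B B' : C} (d : LinearDual B A) (d' : LinearDual B' A) : B ≅ B' where
  hom := lcut d'.η d.ε
  inv := lcut d.η d'.ε
  hom_inv_id := d.left_ext <| by
    rw [MonoidalCategory.whiskerLeft_comp, Category.assoc, d.lcut_ε, d'.lcut_ε,
      MonoidalCategory.whiskerLeft_id, Category.id_comp]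
  inv_hom_id := d'.left_ext <| by
    rw [MonoidalCategory.whiskerLeft_comp, Category.assoc, d'.lcut_ε, d.lcut_ε,
      MonoidalCategory.whiskerLeft_id, Category.id_comp]

end LeftUnique

/-! ### The canonical maps for `(_)^*` and their coherence. -/

section StarMaps

open LinDistrib StarAutonomous

variable {C : Type u} [Category.{v} C] [MonoidalCategory C] [ParMonoidal C] [LinDistrib C]
  [StarAutonomous C]

theorem lstarMap_ε {A B : C} (f : A ⟶ B) :
    A ◁ lstarMap f ≫ (ldual A).ε = f ▷ lstar B ≫ (ldual B).ε :=
  (ldual A).lmate_ε (ldual B) f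

theorem lstarMap_comp {A B D : C} (f : A ⟶ B) (g : B ⟶ D) :
    lstarMap (f ≫ g) = lstarMap g ≫ lstarMap f :=
  (lstarFunctor C).map_comp g.op f.op

theorem lstarMap_id (A : C) : lstarMap (𝟙 A) = 𝟙 (lstar A) :=
  (ldual A).lmate_id

instance {A B : C} (f : A ⟶ B) [IsIso f] : IsIso (lstarMap f) :=
  Functor.map_isIso (lstarFunctor C) f.op

/-- The canonical isomorphism `A^* ⊗ B^* ≅ (B ⊕ A)^*`. -/
def starTensorIso (A B : C) : lstar A ⊗ lstar B ≅ lstar (B ⅋ A) :=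
  ((ldual A).tensor (ldual B)).leftUnique (ldual (B ⅋ A))

theorem starTensorIso_hom (A B : C) : (starTensorIso A B).hom = starTensor A B := rfl

/-- The canonical isomorphism `(A ⊗ B)^* ≅ B^* ⊕ A^*`. -/
def starParIso (A B : C) : lstar (A ⊗ B) ≅ lstar B ⅋ lstar A :=
  (ldual (A ⊗ B)).leftUnique ((ldual B).par (ldual A))

theorem starParIso_hom (A B : C) : (starParIso A B).hom = starPar A B := rfl

/-- By `LinearDual.left_ext` this pairing determines `starTensor`; its naturality and coherence laws
are read off from it. -/
theorem starTensor_ε (A B : C) :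
    (B ⅋ A) ◁ starTensor A B ≫ (ldual (B ⅋ A)).ε = nestCap (ldual B).ε (ldual A).ε :=
  (ldual (B ⅋ A)).lcut_ε _

theorem starParIso_inv_ε (A B : C) :
    (A ⊗ B) ◁ (starParIso A B).inv ≫ (ldual (A ⊗ B)).ε
      = nestCapPar (ldual A).ε (ldual B).ε :=
  (ldual (A ⊗ B)).lcut_ε _

theorem starTensor_η (A B : C) :
    ((ldual A).tensor (ldual B)).η ≫ starTensor A B ▷ₚ (B ⅋ A) = (ldual (B ⅋ A)).η := by
  have h := LinearDual.η_mate ((ldual A).tensor (ldual B)) (ldual (B ⅋ A))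
    (k := starTensor A B) (h := 𝟙 _)
    (by rw [starTensor_ε, id_whiskerRight, Category.id_comp]; rfl)
  rwa [par_whiskerLeft_id, Category.comp_id] at h

theorem starParIso_inv_η (A B : C) :
    ((ldual B).par (ldual A)).η ≫ (starParIso A B).inv ▷ₚ (A ⊗ B) = (ldual (A ⊗ B)).η := by
  have h := LinearDual.η_mate ((ldual B).par (ldual A)) (ldual (A ⊗ B))
    (k := (starParIso A B).inv) (h := 𝟙 _)
    (by rw [starParIso_inv_ε, id_whiskerRight, Category.id_comp]; rfl)
  rwa [par_whiskerLeft_id, Category.comp_id] at h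

theorem lstarMap_η {A B : C} (f : A ⟶ B) :
    (ldual B).η ≫ lstarMap f ▷ₚ B = (ldual A).η ≫ lstar A ◁ₚ f :=
  (ldual B).η_mate (ldual A) (lstarMap_ε f).symm

theorem starTensor_naturality {A A' B B' : C} (f : A ⟶ A') (g : B ⟶ B') :
    (lstarMap f ⊗ₘ lstarMap g) ≫ starTensor A B = starTensor A' B' ≫ lstarMap (g ⅋ₘ f) := by
  apply (ldual (B ⅋ A)).left_ext
  rw [MonoidalCategory.whiskerLeft_comp, MonoidalCategory.whiskerLeft_comp, Category.assoc,
    Category.assoc, starTensor_ε, lstarMap_ε, whisker_exchange_assoc, starTensor_ε]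
  have h1 := nestCap_tensorHom (ldual B).ε (ldual A).ε (lstarMap g) (𝟙 B) (lstarMap f) (𝟙 A)
  have h2 := nestCap_tensorHom (ldual B').ε (ldual A').ε (𝟙 _) g (𝟙 _) f
  have h3 : (𝟙 B ⅋ₘ 𝟙 A) = 𝟙 (B ⅋ A) := @MonoidalCategory.id_tensorHom_id C _ ParMonoidal.mon B A
  simp only [h3, id_whiskerRight, Category.id_comp, lstarMap_ε] at h1
  simp only [MonoidalCategory.id_tensorHom_id, MonoidalCategory.whiskerLeft_id,
    Category.id_comp] at h2
  rw [h1, h2]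

theorem starParIso_inv_naturality {A A' B B' : C} (f : A ⟶ A') (g : B ⟶ B') :
    (lstarMap g ⅋ₘ lstarMap f) ≫ (starParIso A B).inv
      = (starParIso A' B').inv ≫ lstarMap (f ⊗ₘ g) := by
  apply (ldual (A ⊗ B)).left_ext
  rw [MonoidalCategory.whiskerLeft_comp, MonoidalCategory.whiskerLeft_comp, Category.assoc,
    Category.assoc, starParIso_inv_ε, lstarMap_ε, whisker_exchange_assoc, starParIso_inv_ε]
  have h1 := nestCapPar_tensorHom (ldual A).ε (ldual B).ε (lstarMap f) (𝟙 A) (lstarMap g) (𝟙 B)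
  have h2 := nestCapPar_tensorHom (ldual A').ε (ldual B').ε (𝟙 _) f (𝟙 _) g
  have h3 : (𝟙 (lstar B') ⅋ₘ 𝟙 (lstar A')) = 𝟙 (lstar B' ⅋ lstar A') :=
    @MonoidalCategory.id_tensorHom_id C _ ParMonoidal.mon _ _
  simp only [MonoidalCategory.id_tensorHom_id, id_whiskerRight, Category.id_comp,
    lstarMap_ε] at h1
  simp only [h3, MonoidalCategory.whiskerLeft_id, Category.id_comp] at h2
  rw [h1, h2]

/-- Paired with the cap of `(D ⊕ B) ⊕ A`, both sides become a triple nesting, and `nestCap_assoc`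
identifies the groupings. -/
theorem starTensor_assoc (A B D : C) :
    (α_ (lstar A) (lstar B) (lstar D)).hom ≫ lstar A ◁ starTensor B D
        ≫ starTensor A (D ⅋ B)
      = starTensor A B ▷ lstar D ≫ starTensor (B ⅋ A) D
        ≫ lstarMap (parAssoc D B A).hom := by
  rw [← Iso.eq_inv_comp]
  apply (ldual ((D ⅋ B) ⅋ A)).left_ext
  simp only [MonoidalCategory.whiskerLeft_comp, Category.assoc]
  rw [starTensor_ε, lstarMap_ε, whisker_exchange_assoc, whisker_exchange_assoc,
    whisker_exchange_assoc, starTensor_ε]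
  have h1 := nestCap_tensorHom (ldual (D ⅋ B)).ε (ldual A).ε (starTensor B D) (𝟙 _) (𝟙 _) (𝟙 _)
  have h2 := nestCap_tensorHom (ldual D).ε (ldual (B ⅋ A)).ε (𝟙 _) (𝟙 _) (starTensor A B) (𝟙 _)
  have h3 : (𝟙 (D ⅋ B) ⅋ₘ 𝟙 A) = 𝟙 _ := @MonoidalCategory.id_tensorHom_id C _ ParMonoidal.mon _ _
  have h4 : (𝟙 D ⅋ₘ 𝟙 (B ⅋ A)) = 𝟙 _ := @MonoidalCategory.id_tensorHom_id C _ ParMonoidal.mon _ _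
  simp only [h3, id_whiskerRight, MonoidalCategory.id_tensorHom, Category.id_comp,
    MonoidalCategory.whiskerLeft_id, starTensor_ε] at h1
  simp only [h4, id_whiskerRight, MonoidalCategory.tensorHom_id, Category.id_comp,
    MonoidalCategory.whiskerLeft_id, starTensor_ε] at h2
  rw [h1, h2, nestCap_assoc]

theorem starParIso_inv_assoc (A B D : C) :
    (parAssoc (lstar A) (lstar B) (lstar D)).hom ≫ lstar A ◁ₚ (starParIso D B).inv
        ≫ (starParIso (D ⊗ B) A).inv
      = (starParIso B A).inv ▷ₚ lstar D ≫ (starParIso D (B ⊗ A)).inv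
        ≫ lstarMap (α_ D B A).hom := by
  rw [← Iso.eq_inv_comp]
  apply (ldual ((D ⊗ B) ⊗ A)).left_ext
  simp only [MonoidalCategory.whiskerLeft_comp, Category.assoc]
  rw [starParIso_inv_ε, lstarMap_ε, whisker_exchange_assoc, whisker_exchange_assoc,
    whisker_exchange_assoc, starParIso_inv_ε]
  have h1 := nestCapPar_tensorHom (ldual (D ⊗ B)).ε (ldual A).ε (starParIso D B).inv (𝟙 _) (𝟙 _)
    (𝟙 _)
  have h2 := nestCapPar_tensorHom (ldual D).ε (ldual (B ⊗ A)).ε (𝟙 _) (𝟙 _) (starParIso B A).inv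
    (𝟙 _)
  have h3 : (𝟙 (lstar A) ⅋ₘ (starParIso D B).inv) = lstar A ◁ₚ (starParIso D B).inv :=
    @MonoidalCategory.id_tensorHom C _ ParMonoidal.mon _ _ _ _
  have h4 : ((starParIso B A).inv ⅋ₘ 𝟙 (lstar D)) = (starParIso B A).inv ▷ₚ lstar D :=
    @MonoidalCategory.tensorHom_id C _ ParMonoidal.mon _ _ _ _
  simp only [h3, id_whiskerRight, MonoidalCategory.id_tensorHom_id, Category.id_comp,
    MonoidalCategory.whiskerLeft_id, starParIso_inv_ε] at h1
  simp only [h4, id_whiskerRight, MonoidalCategory.id_tensorHom_id, Category.id_comp,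
    MonoidalCategory.whiskerLeft_id, starParIso_inv_ε] at h2
  rw [h1, h2, nestCapPar_assoc]

/-- `(_)^*` reverses both arrows and the order of factors, so it takes `δL` to `δL`; on caps this is
`nestCapPar_nestCap_δL`. -/
theorem star_δL (A B D : C) :
    δL (lstar A) (lstar B) (lstar D) ≫ starTensor A B ▷ₚ lstar D ≫ (starParIso D (B ⅋ A)).inv
      = lstar A ◁ (starParIso D B).inv ≫ starTensor A (D ⊗ B) ≫ lstarMap (δL D B A) := by
  apply (ldual (D ⊗ (B ⅋ A))).left_ext
  simp only [MonoidalCategory.whiskerLeft_comp, Category.assoc]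
  rw [starParIso_inv_ε, lstarMap_ε, whisker_exchange_assoc, whisker_exchange_assoc,
    starTensor_ε]
  have h1 := nestCapPar_tensorHom (ldual D).ε (ldual (B ⅋ A)).ε (𝟙 _) (𝟙 _) (starTensor A B)
    (𝟙 _)
  have h2 := nestCap_tensorHom (ldual (D ⊗ B)).ε (ldual A).ε (starParIso D B).inv (𝟙 _) (𝟙 _)
    (𝟙 _)
  have h3 : (𝟙 (D ⊗ B) ⅋ₘ 𝟙 A) = 𝟙 _ := @MonoidalCategory.id_tensorHom_id C _ ParMonoidal.mon _ _
  have h4 : (starTensor A B ⅋ₘ 𝟙 (lstar D)) = starTensor A B ▷ₚ lstar D :=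
    @MonoidalCategory.tensorHom_id C _ ParMonoidal.mon _ _ _ _
  simp only [h4, id_whiskerRight, MonoidalCategory.id_tensorHom_id, Category.id_comp,
    MonoidalCategory.whiskerLeft_id, starTensor_ε] at h1
  simp only [h3, id_whiskerRight, MonoidalCategory.id_tensorHom, Category.id_comp,
    MonoidalCategory.whiskerLeft_id, starParIso_inv_ε] at h2
  rw [h1, h2, nestCapPar_nestCap_δL]

theorem star_δR (A B D : C) :
    δR (lstar A) (lstar B) (lstar D) ≫ lstar A ◁ₚ starTensor B D ≫ (starParIso (D ⅋ B) A).inv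
      = (starParIso B A).inv ▷ lstar D ≫ starTensor (B ⊗ A) D ≫ lstarMap (δR D B A) := by
  apply (ldual ((D ⅋ B) ⊗ A)).left_ext
  simp only [MonoidalCategory.whiskerLeft_comp, Category.assoc]
  rw [starParIso_inv_ε, lstarMap_ε, whisker_exchange_assoc, whisker_exchange_assoc,
    starTensor_ε]
  have h1 := nestCapPar_tensorHom (ldual (D ⅋ B)).ε (ldual A).ε (starTensor B D) (𝟙 _) (𝟙 _)
    (𝟙 _)
  have h2 := nestCap_tensorHom (ldual D).ε (ldual (B ⊗ A)).ε (𝟙 _) (𝟙 _) (starParIso B A).inv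
    (𝟙 _)
  have h3 : (𝟙 D ⅋ₘ 𝟙 (B ⊗ A)) = 𝟙 _ := @MonoidalCategory.id_tensorHom_id C _ ParMonoidal.mon _ _
  have h4 : (𝟙 (lstar A) ⅋ₘ starTensor B D) = lstar A ◁ₚ starTensor B D :=
    @MonoidalCategory.id_tensorHom C _ ParMonoidal.mon _ _ _ _
  simp only [h4, id_whiskerRight, MonoidalCategory.id_tensorHom_id, Category.id_comp,
    MonoidalCategory.whiskerLeft_id, starTensor_ε] at h1
  simp only [h3, id_whiskerRight, MonoidalCategory.tensorHom_id, Category.id_comp,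
    MonoidalCategory.whiskerLeft_id, starParIso_inv_ε] at h2
  rw [h1, h2, nestCapPar_nestCap_δR]

end StarMaps

/-! ### The cyclor: right caps and the dualizor. -/

section CyclorLemmas

open LinDistrib StarAutonomous

variable {C : Type u} [Category.{v} C] [MonoidalCategory C] [ParMonoidal C] [LinDistrib C]
  [StarAutonomous C]

theorem Cyclor.app_invApp (c : Cyclor C) (A : C) : c.app A ≫ c.invApp A = 𝟙 (lstar A) :=
  c.ψ.hom_inv_id_app (op A)

theorem Cyclor.invApp_app (c : Cyclor C) (A : C) : c.invApp A ≫ c.app A = 𝟙 (rstar A) :=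
  c.ψ.inv_hom_id_app (op A)

/-- The cyclor makes `A^*` a right dual of `A`. -/
def Cyclor.rightDual (c : Cyclor C) (A : C) : LinearDual A (lstar A) where
  η := (rdual A).η ≫ A ◁ₚ c.invApp A
  ε := c.app A ▷ A ≫ (rdual A).ε
  snake_left := by
    rw [lcut_whiskerLeft, ← comp_whiskerRight_assoc, c.invApp_app, id_whiskerRight,
      Category.id_comp, (rdual A).snake_left]
  snake_right := by
    rw [← rcut_comp, (rdual A).rcut_comp_ε, c.app_invApp]

theorem Cyclor.rightDual_ε (c : Cyclor C) (A : C) :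
    (c.rightDual A).ε = c.app A ▷ A ≫ (rdual A).ε := rfl

/-- Naturality of `ψ` in terms of caps: `f^*`, defined as a mate for the left caps, is also a mate
for the right caps. -/
theorem Cyclor.lstarMap_rightDual_ε (c : Cyclor C) {A B : C} (f : A ⟶ B) :
    lstarMap f ▷ A ≫ (c.rightDual A).ε = lstar B ◁ f ≫ (c.rightDual B).ε := by
  have h : lstarMap f ≫ c.app A = c.app B ≫ (rdual A).rmate (rdual B) f :=
    c.ψ.hom.naturality f.op
  rw [c.rightDual_ε, ← comp_whiskerRight_assoc, h, comp_whiskerRight, Category.assoc,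
    LinearDual.rmate_ε, c.rightDual_ε, whisker_exchange_assoc]

theorem Cyclor.rightDual_η_lstarMap (c : Cyclor C) {A B : C} (f : A ⟶ B) :
    (c.rightDual A).η ≫ f ▷ₚ lstar A = (c.rightDual B).η ≫ B ◁ₚ lstarMap f :=
  (c.rightDual A).η_mate (c.rightDual B) (c.lstarMap_rightDual_ε f)

/-- `tensor_coh` in terms of caps: right caps nest along the same canonical map as left caps. -/
theorem Cyclor.starParIso_inv_rightDual_ε (c : Cyclor C) (A B : C) :
    (starParIso A B).inv ▷ (A ⊗ B) ≫ (c.rightDual (A ⊗ B)).ε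
      = nestCap (c.rightDual B).ε (c.rightDual A).ε := by
  have h := ((rdual A).tensor (rdual B)).rcut_ε (rdual (A ⊗ B)).ε
  have h' : c.app (A ⊗ B) ≫ rcut ((rdual A).tensor (rdual B)).η (rdual (A ⊗ B)).ε
      = (starParIso A B).hom ≫ (c.app B ⅋ₘ c.app A) := c.tensor_coh A B
  have h1 := nestCap_tensorHom (rdual B).ε (rdual A).ε (𝟙 _) (c.app B) (𝟙 _) (c.app A)
  simp only [MonoidalCategory.id_tensorHom_id, MonoidalCategory.whiskerLeft_id,
    Category.id_comp] at h1
  rw [c.rightDual_ε, ← h, ← comp_whiskerRight_assoc, ← comp_whiskerRight_assoc, Category.assoc,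
    h', Iso.inv_hom_id_assoc]
  exact h1

theorem Cyclor.starTensor_rightDual_ε (c : Cyclor C) (A B : C) :
    starTensor A B ▷ (B ⅋ A) ≫ (c.rightDual (B ⅋ A)).ε
      = nestCapPar (c.rightDual A).ε (c.rightDual B).ε := by
  have h := ((rdual B).par (rdual A)).rcut_ε (rdual (B ⅋ A)).ε
  have h' : c.app (B ⅋ A) ≫ rcut ((rdual B).par (rdual A)).η (rdual (B ⅋ A)).ε
      = (starTensorIso A B).inv ≫ (c.app A ⊗ₘ c.app B) := c.par_coh B A
  have h1 := nestCapPar_tensorHom (rdual A).ε (rdual B).ε (𝟙 _) (c.app A) (𝟙 _) (c.app B)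
  have h2 : (𝟙 B ⅋ₘ 𝟙 A) = 𝟙 _ := @MonoidalCategory.id_tensorHom_id C _ ParMonoidal.mon _ _
  simp only [h2, MonoidalCategory.whiskerLeft_id, Category.id_comp] at h1
  rw [c.rightDual_ε, ← h, ← comp_whiskerRight_assoc, ← comp_whiskerRight_assoc, Category.assoc,
    h', ← starTensorIso_hom, Iso.hom_inv_id_assoc]
  exact h1

/-- Immediate from the definition of `d_A`, whose `ψ⁻¹` cancels the `ψ` in the right cap. -/
theorem Cyclor.dualizor_whiskerRight_ε (c : Cyclor C) (A : C) :
    c.dualizor A ▷ lstar A ≫ (c.rightDual (lstar A)).ε = (ldual A).ε := by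
  rw [c.rightDual_ε, ← comp_whiskerRight_assoc, Cyclor.dualizor, Category.assoc, c.invApp_app,
    Category.comp_id, (rdual (lstar A)).rcut_ε]

/-- The mirror statement needs `double_coh`, which gives a second formula for `d_A`, through
`(^*A)^*`. -/
theorem Cyclor.whiskerLeft_dualizor_ε (c : Cyclor C) (A : C) :
    lstar A ◁ c.dualizor A ≫ (ldual (lstar A)).ε = (c.rightDual A).ε := by
  have h : lcut (ldual (rstar A)).η (rdual A).ε ≫ lstarMap (c.app A) ≫ c.app (lstar A)
      = rcut (rdual (lstar A)).η (ldual A).ε := c.double_coh A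
  rw [Cyclor.dualizor, ← h, Category.assoc, Category.assoc, c.app_invApp, Category.comp_id,
    MonoidalCategory.whiskerLeft_comp, Category.assoc, lstarMap_ε, whisker_exchange_assoc,
    (ldual (rstar A)).lcut_ε, c.rightDual_ε]

/-- The dualizor as an isomorphism. -/
def Cyclor.dualizorIso (c : Cyclor C) (A : C) : A ≅ lstar (lstar A) :=
  (c.rightDual A).leftUnique (ldual (lstar A))

theorem Cyclor.dualizorIso_hom (c : Cyclor C) (A : C) : (c.dualizorIso A).hom = c.dualizor A :=
  (ldual (lstar A)).left_ext <| by
    rw [c.whiskerLeft_dualizor_ε, Cyclor.dualizorIso, LinearDual.leftUnique_hom,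
      LinearDual.lcut_ε]

instance (c : Cyclor C) (A : C) : IsIso (c.dualizor A) :=
  c.dualizorIso_hom A ▸ inferInstance

theorem Cyclor.dualizor_naturality (c : Cyclor C) {A B : C} (f : A ⟶ B) :
    f ≫ c.dualizor B = c.dualizor A ≫ lstarMap (lstarMap f) := by
  apply (ldual (lstar B)).left_ext
  rw [MonoidalCategory.whiskerLeft_comp, MonoidalCategory.whiskerLeft_comp, Category.assoc,
    Category.assoc, c.whiskerLeft_dualizor_ε, lstarMap_ε, whisker_exchange_assoc,
    c.whiskerLeft_dualizor_ε, c.lstarMap_rightDual_ε]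

/-- The dualizor first turns a left cap into a right one and then back; this is the core of both
triangle identities. -/
theorem Cyclor.dualizor_lstarMap_dualizor (c : Cyclor C) (A : C) :
    c.dualizor (lstar A) ≫ lstarMap (c.dualizor A) = 𝟙 (lstar A) := by
  apply (ldual A).left_ext
  rw [MonoidalCategory.whiskerLeft_comp, Category.assoc, lstarMap_ε, whisker_exchange_assoc,
    c.whiskerLeft_dualizor_ε, c.dualizor_whiskerRight_ε, MonoidalCategory.whiskerLeft_id,
    Category.id_comp]

theorem Cyclor.dualizor_η (c : Cyclor C) (A : C) :
    (c.rightDual (lstar A)).η = (ldual A).η ≫ lstar A ◁ₚ c.dualizor A := by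
  have h := (c.rightDual (lstar A)).η_mate (ldual A) (k := 𝟙 _) (h := c.dualizor A)
    (by rw [c.dualizor_whiskerRight_ε, MonoidalCategory.whiskerLeft_id, Category.id_comp])
  rwa [par_id_whiskerRight, Category.comp_id] at h

end CyclorLemmas

/-! ### The comparison `ω`, the isomorphism `A^* ≅ A^{†*†}` and the conjugator. -/

section Conjugator

open LinDistrib StarAutonomous DaggerLDC

variable {C : Type u} [Category.{v} C] [MonoidalCategory C] [ParMonoidal C] [LinDistrib C]
  [StarAutonomous C] [DaggerLDC C]

/-- The isomorphism `A^{†*} ≅ A^{*†}` between the two left duals of `A^†`. -/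
def Cyclor.omegaIso (c : Cyclor C) (A : C) : lstar (dg A) ≅ dg (lstar A) :=
  (ldual (dg A)).leftUnique (c.rightDual A).dagger

/-- The factor `ψ^†` is absorbed into the dagger of the right cap, so `ω` is the comparison of two
left duals of `A^†`. -/
theorem Cyclor.omegaIso_hom (c : Cyclor C) (A : C) : (c.omegaIso A).hom = c.omega A := by
  rw [Cyclor.omega, lcut_comp, ← dagCup_whiskerRight]
  rfl

theorem Cyclor.omega_ε (c : Cyclor C) (A : C) :
    dg A ◁ c.omega A ≫ dagCap (c.rightDual A).η = (ldual (dg A)).ε := by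
  rw [← c.omegaIso_hom]
  exact (c.rightDual A).dagger.lcut_ε _

theorem Cyclor.η_omega (c : Cyclor C) (A : C) :
    (ldual (dg A)).η ≫ c.omega A ▷ₚ dg A = dagCup (c.rightDual A).ε := by
  have h := (ldual (dg A)).η_mate (c.rightDual A).dagger (k := c.omega A) (h := 𝟙 _)
    (by rw [id_whiskerRight, Category.id_comp]; exact (c.omega_ε A).symm)
  rwa [par_whiskerLeft_id, Category.comp_id] at h

theorem Cyclor.omega_naturality (c : Cyclor C) {A B : C} (f : A ⟶ B) :
    lstarMap (dgMap f) ≫ c.omega B = c.omega A ≫ dgMap (lstarMap f) := by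
  apply (c.rightDual B).dagger.left_ext
  have h : (c.rightDual B).dagger.ε = dagCap (c.rightDual B).η := rfl
  rw [h, MonoidalCategory.whiskerLeft_comp, MonoidalCategory.whiskerLeft_comp, Category.assoc,
    Category.assoc, c.omega_ε, lstarMap_ε, ← dagCap_whiskerLeft, ← c.rightDual_η_lstarMap,
    dagCap_whiskerRight, whisker_exchange_assoc, c.omega_ε]

/-- The isomorphism `A^* ≅ A^{†*†}` underlying the conjugator. -/
def Cyclor.starConj (c : Cyclor C) (A : C) : lstar A ≅ dg (lstar (dg A)) :=
  DaggerLDC.ι.app (lstar A) ≪≫ DaggerLDC.dag.mapIso (c.omegaIso A).op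

theorem Cyclor.starConj_hom (c : Cyclor C) (A : C) :
    (c.starConj A).hom = involutor (lstar A) ≫ dgMap (c.omega A) := by
  rw [← c.omegaIso_hom]
  rfl

/-- The factor `ω^†` turns the dagger of the left cup of `A^†` into a double dagger of the right cap
of `A`, which `ι` undoes. -/
theorem Cyclor.starConj_dagCap (c : Cyclor C) (A : C) :
    ((c.starConj A).hom ⊗ₘ involutor A) ≫ dagCap (ldual (dg A)).η = (c.rightDual A).ε := by
  rw [c.starConj_hom, tensorHom_def', comp_whiskerRight, Category.assoc, Category.assoc,
    ← dagCap_whiskerRight, c.η_omega, ← tensorHom_def'_assoc, involutor_dagCap_dagCup]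

theorem Cyclor.starConj_whiskerRight_dagCap (c : Cyclor C) (A : C) :
    (c.starConj A).hom ▷ dg (dg A) ≫ dagCap (ldual (dg A)).η
      = lstar A ◁ involutorInv A ≫ (c.rightDual A).ε := by
  rw [← c.starConj_dagCap, tensorHom_def', ← Category.assoc, ← Category.assoc,
    ← MonoidalCategory.whiskerLeft_comp, involutorInv_involutor, MonoidalCategory.whiskerLeft_id,
    Category.id_comp]

/-- The conjugator `A^{†*†*} ⟶ A`. -/
def Cyclor.conjugator (c : Cyclor C) (A : C) : lstar (dg (lstar (dg A))) ⟶ A :=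
  c.omega (lstar (dg A)) ≫ c.compositeCounit A

/-- The inverse `A ⟶ A^{†*†*}` of the conjugator. -/
def Cyclor.conjugatorInv (c : Cyclor C) (A : C) : A ⟶ lstar (dg (lstar (dg A))) :=
  c.compositeUnit A ≫ lstarMap (dgMap (c.omegaIso A).inv)

/-- This exhibits the conjugator as the mate of `starConj`: `omega_ε` and `dualizor_η` express the
left cap of `A^{†*†}` through `ω` and `d^†`, and `starConj` carries what remains to the right cap of
`A`. -/
theorem Cyclor.conjugator_ε (c : Cyclor C) (A : C) :
    lstar A ◁ c.conjugator A ≫ (c.rightDual A).ε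
      = (c.starConj A).hom ▷ lstar (dg (lstar (dg A))) ≫ (ldual (dg (lstar (dg A)))).ε := by
  rw [← c.omega_ε, c.dualizor_η, dagCap_whiskerLeft, ← whisker_exchange_assoc,
    ← whisker_exchange_assoc, c.starConj_whiskerRight_dagCap, Cyclor.conjugator,
    Cyclor.compositeCounit]
  simp only [MonoidalCategory.whiskerLeft_comp, Category.assoc]

theorem Cyclor.compositeUnit_ε (c : Cyclor C) (A : C) :
    dg (dg (lstar A)) ◁ c.compositeUnit A ≫ (ldual (dg (dg (lstar A)))).ε
      = involutorInv (lstar A) ▷ A ≫ (c.rightDual A).ε := by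
  rw [Cyclor.compositeUnit, MonoidalCategory.whiskerLeft_comp, Category.assoc, lstarMap_ε,
    whisker_exchange_assoc, c.whiskerLeft_dualizor_ε]

/-- The same pairing read backwards: the `ω⁻¹` in `conjugatorInv` cancels the `ω` in `starConj`,
leaving `ι` against its inverse. -/
theorem Cyclor.conjugatorInv_ε (c : Cyclor C) (A : C) :
    (c.starConj A).hom ▷ A ≫ dg (lstar (dg A)) ◁ c.conjugatorInv A
        ≫ (ldual (dg (lstar (dg A)))).ε
      = (c.rightDual A).ε := by
  have h : c.starConj A ≪≫ DaggerLDC.dag.mapIso (c.omegaIso A).symm.op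
      = DaggerLDC.ι.app (lstar A) := by
    ext
    have := (DaggerLDC.dag.mapIso (c.omegaIso A).op).hom_inv_id
    simp only [Cyclor.starConj, Iso.trans_assoc, Iso.trans_hom]
    exact (congrArg (involutor (lstar A) ≫ ·) this).trans (Category.comp_id _)
  have h' : (c.starConj A).hom ≫ dgMap (c.omegaIso A).inv = involutor (lstar A) :=
    congrArg Iso.hom h
  rw [Cyclor.conjugatorInv, MonoidalCategory.whiskerLeft_comp, Category.assoc, lstarMap_ε,
    whisker_exchange_assoc, c.compositeUnit_ε, ← comp_whiskerRight_assoc,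
    ← comp_whiskerRight_assoc, h', involutor_involutorInv, id_whiskerRight, Category.id_comp]

theorem Cyclor.conjugatorInv_conjugator (c : Cyclor C) (A : C) :
    c.conjugatorInv A ≫ c.conjugator A = 𝟙 A := by
  apply (c.rightDual A).left_ext
  rw [MonoidalCategory.whiskerLeft_comp, Category.assoc, c.conjugator_ε, whisker_exchange_assoc,
    c.conjugatorInv_ε, MonoidalCategory.whiskerLeft_id, Category.id_comp]

end Conjugator

/-! ### One-variable naturality of the canonical star maps. -/

section StarNaturality

open LinDistrib StarAutonomous

variable {C : Type u} [Category.{v} C] [MonoidalCategory C] [ParMonoidal C] [LinDistrib C]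
  [StarAutonomous C]

theorem starTensor_naturality_left {A A' : C} (f : A ⟶ A') (B : C) :
    lstarMap f ▷ lstar B ≫ starTensor A B = starTensor A' B ≫ lstarMap (B ◁ₚ f) := by
  have h := starTensor_naturality f (𝟙 B)
  have h1 : (𝟙 B ⅋ₘ f) = B ◁ₚ f := @MonoidalCategory.id_tensorHom C _ ParMonoidal.mon _ _ _ _
  rwa [lstarMap_id, MonoidalCategory.tensorHom_id, h1] at h

theorem starTensor_naturality_right (A : C) {B B' : C} (g : B ⟶ B') :
    lstar A ◁ lstarMap g ≫ starTensor A B = starTensor A B' ≫ lstarMap (g ▷ₚ A) := by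
  have h := starTensor_naturality (𝟙 A) g
  have h1 : (g ⅋ₘ 𝟙 A) = g ▷ₚ A := @MonoidalCategory.tensorHom_id C _ ParMonoidal.mon _ _ _ _
  rwa [lstarMap_id, MonoidalCategory.id_tensorHom, h1] at h

theorem starParIso_inv_naturality_left {B B' : C} (g : B ⟶ B') (A : C) :
    lstarMap g ▷ₚ lstar A ≫ (starParIso A B).inv
      = (starParIso A B').inv ≫ lstarMap (A ◁ g) := by
  have h := starParIso_inv_naturality (𝟙 A) g
  have h1 : (lstarMap g ⅋ₘ 𝟙 (lstar A)) = lstarMap g ▷ₚ lstar A :=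
    @MonoidalCategory.tensorHom_id C _ ParMonoidal.mon _ _ _ _
  rwa [lstarMap_id, MonoidalCategory.id_tensorHom, h1] at h

theorem starParIso_inv_naturality_right (B : C) {A A' : C} (f : A ⟶ A') :
    lstar B ◁ₚ lstarMap f ≫ (starParIso A B).inv
      = (starParIso A' B).inv ≫ lstarMap (f ▷ B) := by
  have h := starParIso_inv_naturality f (𝟙 B)
  have h1 : (𝟙 (lstar B) ⅋ₘ lstarMap f) = lstar B ◁ₚ lstarMap f :=
    @MonoidalCategory.id_tensorHom C _ ParMonoidal.mon _ _ _ _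
  rwa [lstarMap_id, MonoidalCategory.tensorHom_id, h1] at h

theorem starPar_naturality_left (B : C) {A A' : C} (f : A ⟶ A') :
    starPar A' B ≫ lstar B ◁ₚ lstarMap f = lstarMap (f ▷ B) ≫ starPar A B := by
  rw [← starParIso_hom, ← starParIso_hom, ← Iso.eq_inv_comp, ← Category.assoc, ← Iso.comp_inv_eq,
    starParIso_inv_naturality_right]

theorem starPar_naturality_right {B B' : C} (g : B ⟶ B') (A : C) :
    starPar A B' ≫ lstarMap g ▷ₚ lstar A = lstarMap (A ◁ g) ≫ starPar A B := by
  rw [← starParIso_hom, ← starParIso_hom, ← Iso.eq_inv_comp, ← Category.assoc, ← Iso.comp_inv_eq,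
    starParIso_inv_naturality_left]

end StarNaturality

/-! ### The laxors of `(_)^{†*}`: naturality, associators, distributors. -/

section ConjugatingLaxors

open LinDistrib StarAutonomous DaggerLDC

variable {C : Type u} [Category.{v} C] [MonoidalCategory C] [ParMonoidal C] [LinDistrib C]
  [StarAutonomous C] [DaggerLDC C]

/-- The isomorphism `A^{†*} ⊗ B^{†*} ≅ (B ⊗ A)^{†*}`. -/
def daggerStarTensorIso (A B : C) : lstar (dg A) ⊗ lstar (dg B) ≅ lstar (dg (B ⊗ A)) :=
  starTensorIso (dg A) (dg B) ≪≫ (lstarFunctor C).mapIso (lamP B A).symm.op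

/-- The isomorphism `(A ⊕ B)^{†*} ≅ B^{†*} ⊕ A^{†*}`. -/
def daggerStarParIso (A B : C) : lstar (dg (A ⅋ B)) ≅ lstar (dg B) ⅋ lstar (dg A) :=
  (lstarFunctor C).mapIso (lamT A B).op ≪≫ starParIso (dg A) (dg B)

theorem daggerStarParIso_inv (A B : C) : (daggerStarParIso A B).inv
    = (starParIso (dg A) (dg B)).inv ≫ lstarMap (lamT A B).inv := rfl

theorem daggerStarTensor_naturality {A A' B B' : C} (f : A ⟶ A') (g : B ⟶ B') :
    (lstarMap (dgMap f) ⊗ₘ lstarMap (dgMap g)) ≫ daggerStarTensor A' B'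
      = daggerStarTensor A B ≫ lstarMap (dgMap (g ⊗ₘ f)) := by
  have h := lamP_natural g f
  rw [← Iso.inv_comp_eq, ← Category.assoc, ← Iso.eq_comp_inv] at h
  unfold daggerStarTensor
  rw [reassoc_of% (starTensor_naturality (dgMap f) (dgMap g)), Category.assoc, ← lstarMap_comp,
    ← lstarMap_comp, ← h]

theorem daggerStarParIso_inv_naturality {A A' B B' : C} (f : A ⟶ A') (g : B ⟶ B') :
    (lstarMap (dgMap f) ⅋ₘ lstarMap (dgMap g)) ≫ (daggerStarParIso B' A').inv
      = (daggerStarParIso B A).inv ≫ lstarMap (dgMap (g ⅋ₘ f)) := by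
  have h := lamT_natural g f
  rw [← Iso.inv_comp_eq, ← Category.assoc, ← Iso.eq_comp_inv] at h
  rw [daggerStarParIso_inv, daggerStarParIso_inv,
    reassoc_of% (starParIso_inv_naturality (dgMap g) (dgMap f)), Category.assoc, ← lstarMap_comp,
    ← lstarMap_comp, ← h]

theorem daggerStarTensor_assoc (A B D : C) :
    (α_ (lstar (dg A)) (lstar (dg B)) (lstar (dg D))).hom
        ≫ lstar (dg A) ◁ daggerStarTensor B D ≫ daggerStarTensor A (D ⊗ B)
      = daggerStarTensor A B ▷ lstar (dg D) ≫ daggerStarTensor (B ⊗ A) D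
        ≫ lstarMap (dgMap (α_ D B A).inv) := by
  -- `lamP_assoc` with the laxors inverted, because the conjugating laxor applies `(_)^*` to
  -- `lamP⁻¹`.
  have h : (lamP (D ⊗ B) A).inv ≫ (lamP D B).inv ▷ₚ dg A ≫ (parAssoc (dg D) (dg B) (dg A)).hom
      = dgMap (α_ D B A).inv ≫ (lamP D (B ⊗ A)).inv ≫ dg D ◁ₚ (lamP B A).inv := by
    have k : (lamP (D ⊗ B) A).hom = (lamP D B).inv ▷ₚ dg A ≫ (parAssoc (dg D) (dg B) (dg A)).hom
        ≫ dg D ◁ₚ (lamP B A).hom ≫ (lamP D (B ⊗ A)).hom ≫ dgMap (α_ D B A).hom := by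
      rw [← lamP_assoc, Iso.hom_inv_id_assoc,
        reassoc_of% (par_inv_hom_whiskerRight (lamP D B) (dg A))]
    rw [Iso.inv_comp_eq, k]
    simp only [Category.assoc]
    rw [← reassoc_of% (dgMap_comp (α_ D B A).inv (α_ D B A).hom), Iso.inv_hom_id, dgMap_id,
      Category.id_comp, Iso.hom_inv_id_assoc, par_whiskerLeft_hom_inv, Category.comp_id]
  unfold daggerStarTensor
  simp only [MonoidalCategory.whiskerLeft_comp, comp_whiskerRight, Category.assoc]
  rw [reassoc_of% (starTensor_naturality_right (dg A) (lamP D B).inv),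
    reassoc_of% (starTensor_naturality_left (lamP B A).inv (dg D)),
    reassoc_of% (starTensor_assoc (dg A) (dg B) (dg D))]
  simp only [← lstarMap_comp, Category.assoc]
  rw [h]

theorem daggerStarParIso_inv_assoc (A B D : C) :
    (parAssoc (lstar (dg A)) (lstar (dg B)) (lstar (dg D))).hom
        ≫ lstar (dg A) ◁ₚ (daggerStarParIso D B).inv ≫ (daggerStarParIso (D ⅋ B) A).inv
      = (daggerStarParIso B A).inv ▷ₚ lstar (dg D) ≫ (daggerStarParIso D (B ⅋ A)).inv
        ≫ lstarMap (dgMap (parAssoc D B A).inv) := by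
  have h : (lamT (D ⅋ B) A).inv ≫ (lamT D B).inv ▷ dg A ≫ (α_ (dg D) (dg B) (dg A)).hom
      = dgMap (parAssoc D B A).inv ≫ (lamT D (B ⅋ A)).inv ≫ dg D ◁ (lamT B A).inv := by
    have k : (lamT (D ⅋ B) A).hom = (lamT D B).inv ▷ dg A ≫ (α_ (dg D) (dg B) (dg A)).hom
        ≫ dg D ◁ (lamT B A).hom ≫ (lamT D (B ⅋ A)).hom ≫ dgMap (parAssoc D B A).hom := by
      rw [← lamT_assoc, Iso.hom_inv_id_assoc, inv_hom_whiskerRight_assoc]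
    rw [Iso.inv_comp_eq, k]
    simp only [Category.assoc]
    rw [← reassoc_of% (dgMap_comp (parAssoc D B A).inv (parAssoc D B A).hom), Iso.inv_hom_id,
      dgMap_id, Category.id_comp, Iso.hom_inv_id_assoc, whiskerLeft_hom_inv, Category.comp_id]
  simp only [daggerStarParIso_inv, par_whiskerLeft_comp, par_comp_whiskerRight, Category.assoc]
  rw [reassoc_of% (starParIso_inv_naturality_right (dg A) (lamT D B).inv),
    reassoc_of% (starParIso_inv_naturality_left (lamT B A).inv (dg D)),
    reassoc_of% (starParIso_inv_assoc (dg A) (dg B) (dg D))]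
  simp only [← lstarMap_comp, Category.assoc]
  rw [h]

/-- The dagger exchanges `δL` and `δR` (`lam_δR`) while the star keeps each (`star_δR`), so
conjugation exchanges them. -/
theorem daggerStar_δL (A B D : C) :
    daggerStarPar B D ▷ lstar (dg A) ≫ δR (lstar (dg D)) (lstar (dg B)) (lstar (dg A))
        ≫ lstar (dg D) ◁ₚ daggerStarTensor B A
      = daggerStarTensor (B ⅋ D) A ≫ lstarMap (dgMap (δL A B D)) ≫ daggerStarPar (A ⊗ B) D := by
  have h : (lamP A B).inv ▷ dg D ≫ δR (dg A) (dg B) (dg D) ≫ dg A ◁ₚ (lamT B D).hom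
      = (lamT (A ⊗ B) D).hom ≫ dgMap (δL A B D) ≫ (lamP A (B ⅋ D)).inv := by
    have := lam_δR A B D
    rw [← cancel_mono (lamP A (B ⅋ D)).hom]
    simp only [Category.assoc, Iso.inv_hom_id, Category.comp_id]
    rw [this, inv_hom_whiskerRight_assoc]
  have h' : (starParIso (dg B) (dg D)).hom ▷ lstar (dg A)
        ≫ δR (lstar (dg D)) (lstar (dg B)) (lstar (dg A))
        ≫ lstar (dg D) ◁ₚ starTensor (dg B) (dg A)
      = starTensor (dg B ⊗ dg D) (dg A) ≫ lstarMap (δR (dg A) (dg B) (dg D))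
        ≫ starPar (dg A ⅋ dg B) (dg D) := by
    rw [← cancel_mono (starParIso (dg A ⅋ dg B) (dg D)).inv]
    simp only [Category.assoc, ← starParIso_hom, Iso.hom_inv_id, Category.comp_id]
    rw [star_δR, hom_inv_whiskerRight_assoc]
  unfold daggerStarPar daggerStarTensor
  simp only [comp_whiskerRight, par_whiskerLeft_comp, Category.assoc]
  rw [← starParIso_hom (dg B), reassoc_of% h', starPar_naturality_left,
    reassoc_of% (starTensor_naturality_left (lamT B D).hom (dg A))]
  simp only [← reassoc_of% @lstarMap_comp, Category.assoc]
  rw [h]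

theorem daggerStar_δR (A B D : C) :
    lstar (dg A) ◁ daggerStarPar D B ≫ δL (lstar (dg A)) (lstar (dg B)) (lstar (dg D))
        ≫ daggerStarTensor A B ▷ₚ lstar (dg D)
      = daggerStarTensor A (D ⅋ B) ≫ lstarMap (dgMap (δR D B A)) ≫ daggerStarPar D (B ⊗ A) := by
  have h : dg D ◁ (lamP B A).inv ≫ δL (dg D) (dg B) (dg A) ≫ (lamT D B).hom ▷ₚ dg A
      = (lamT D (B ⊗ A)).hom ≫ dgMap (δR D B A) ≫ (lamP (D ⅋ B) A).inv := by
    have := lam_δL D B A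
    rw [← cancel_mono (lamP (D ⅋ B) A).hom]
    simp only [Category.assoc, Iso.inv_hom_id, Category.comp_id]
    rw [this, whiskerLeft_inv_hom_assoc]
  have h' : lstar (dg A) ◁ (starParIso (dg D) (dg B)).hom
        ≫ δL (lstar (dg A)) (lstar (dg B)) (lstar (dg D))
        ≫ starTensor (dg A) (dg B) ▷ₚ lstar (dg D)
      = starTensor (dg A) (dg D ⊗ dg B) ≫ lstarMap (δL (dg D) (dg B) (dg A))
        ≫ starPar (dg D) (dg B ⅋ dg A) := by
    rw [← cancel_mono (starParIso (dg D) (dg B ⅋ dg A)).inv]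
    simp only [Category.assoc, ← starParIso_hom, Iso.hom_inv_id, Category.comp_id]
    rw [star_δL, whiskerLeft_hom_inv_assoc]
  unfold daggerStarPar daggerStarTensor
  simp only [MonoidalCategory.whiskerLeft_comp, par_comp_whiskerRight, Category.assoc]
  rw [← starParIso_hom (dg D), reassoc_of% h', starPar_naturality_right,
    reassoc_of% (starTensor_naturality_right (dg A) (lamT D B).hom)]
  simp only [← reassoc_of% @lstarMap_comp, Category.assoc]
  rw [h]

end ConjugatingLaxors

/-! ### The conjugator is monoidal for the tensor and the par. -/

section ConjugatorCoherence

open LinDistrib StarAutonomous DaggerLDC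

variable {C : Type u} [Category.{v} C] [MonoidalCategory C] [ParMonoidal C] [LinDistrib C]
  [StarAutonomous C] [DaggerLDC C]

/-- The involutor as an isomorphism. -/
abbrev involutorIso (A : C) : A ≅ dg (dg A) := DaggerLDC.ι.app A

theorem daggerStarTensor_ε (A B : C) :
    dg (B ⊗ A) ◁ daggerStarTensor A B ≫ (ldual (dg (B ⊗ A))).ε
      = (lamP B A).inv ▷ (lstar (dg A) ⊗ lstar (dg B))
        ≫ nestCap (ldual (dg B)).ε (ldual (dg A)).ε := by
  rw [daggerStarTensor, MonoidalCategory.whiskerLeft_comp, Category.assoc, lstarMap_ε,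
    whisker_exchange_assoc, starTensor_ε]

theorem daggerStarParIso_inv_ε (A B : C) :
    dg (A ⅋ B) ◁ (daggerStarParIso A B).inv ≫ (ldual (dg (A ⅋ B))).ε
      = (lamT A B).inv ▷ (lstar (dg B) ⅋ lstar (dg A))
        ≫ nestCapPar (ldual (dg A)).ε (ldual (dg B)).ε := by
  rw [daggerStarParIso_inv, MonoidalCategory.whiskerLeft_comp, Category.assoc, lstarMap_ε,
    whisker_exchange_assoc, starParIso_inv_ε]

theorem daggerStarTensor_η (A B : C) :
    ((ldual (dg A)).tensor (ldual (dg B))).η ≫ daggerStarTensor A B ▷ₚ (dg B ⅋ dg A)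
      = (ldual (dg (B ⊗ A))).η ≫ lstar (dg (B ⊗ A)) ◁ₚ (lamP B A).inv := by
  rw [daggerStarTensor, par_comp_whiskerRight, reassoc_of% (starTensor_η (dg A) (dg B)),
    lstarMap_η]

theorem daggerStarParIso_inv_η (A B : C) :
    ((ldual (dg B)).par (ldual (dg A))).η ≫ (daggerStarParIso A B).inv ▷ₚ (dg A ⊗ dg B)
      = (ldual (dg (A ⅋ B))).η ≫ lstar (dg (A ⅋ B)) ◁ₚ (lamT A B).inv := by
  rw [daggerStarParIso_inv, par_comp_whiskerRight, reassoc_of% (starParIso_inv_η (dg A) (dg B)),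
    lstarMap_η]

/-- Both sides, paired with the dagger of a nested left cup, give the nesting of the right caps of
`A` and `B`. This is the input for `conjugator_tensor`. -/
theorem Cyclor.starConj_par (c : Cyclor C) (A B : C) :
    (starParIso B A).inv ≫ (c.starConj (B ⊗ A)).hom ≫ dgMap (daggerStarTensor A B)
      = ((c.starConj A).hom ⅋ₘ (c.starConj B).hom) ≫ (lamP (lstar (dg A)) (lstar (dg B))).hom := by
  -- `J` identifies `B ⊗ A` with `(B^† ⊕ A^†)^†`, the right leg of the test cap; cancelling it
  -- brings the pairing down to `B ⊗ A`, where the right caps live.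
  let J := (involutorIso B ⊗ᵢ involutorIso A) ≪≫ lamT (dg B) (dg A)
  have hJ : J.hom = (involutor B ⊗ₘ involutor A) ≫ (lamT (dg B) (dg A)).hom := rfl
  have hι : J.hom ≫ dgMap (lamP B A).inv = involutor (B ⊗ A) := by
    rw [hJ, Category.assoc, ← reassoc_of% (ι_tensor B A), ← dgMap_comp, Iso.inv_hom_id, dgMap_id]
    exact Category.comp_id _
  have hL : dgMap (daggerStarTensor A B) ▷ dg (dg B ⅋ dg A)
        ≫ dagCap (nestTensorPar (ldual (dg A)).η (ldual (dg B)).η)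
      = dg (lstar (dg (B ⊗ A))) ◁ dgMap (lamP B A).inv ≫ dagCap (ldual (dg (B ⊗ A))).η := by
    rw [← dagCap_whiskerRight, ← dagCap_whiskerLeft, ← daggerStarTensor_η]
    rfl
  apply ((ldual (dg A)).tensor (ldual (dg B))).dagger.right_ext
  rw [← cancel_epi ((lstar A ⅋ lstar B) ◁ J.hom)]
  change _ ≫ _ ≫ dagCap (nestTensorPar (ldual (dg A)).η (ldual (dg B)).η)
    = _ ≫ _ ≫ dagCap (nestTensorPar (ldual (dg A)).η (ldual (dg B)).η)
  simp only [comp_whiskerRight, Category.assoc, hL]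
  rw [whisker_exchange_assoc, whisker_exchange_assoc, whisker_exchange_assoc,
    ← MonoidalCategory.whiskerLeft_comp_assoc, hι, ← MonoidalCategory.tensorHom_def_assoc,
    c.starConj_dagCap, c.starParIso_inv_rightDual_ε, hJ, MonoidalCategory.whiskerLeft_comp,
    Category.assoc, whisker_exchange_assoc, dagCap_nestTensorPar, nestCap_tensorHom,
    ← MonoidalCategory.tensorHom_def_assoc, ← MonoidalCategory.tensorHom_def_assoc,
    c.starConj_dagCap, c.starConj_dagCap]

theorem Cyclor.starConj_tensor (c : Cyclor C) (A B : C) :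
    starTensor A B ≫ (c.starConj (B ⅋ A)).hom ≫ dgMap (daggerStarParIso B A).inv
      = ((c.starConj A).hom ⊗ₘ (c.starConj B).hom)
        ≫ (lamT (lstar (dg A)) (lstar (dg B))).hom := by
  let J := (@MonoidalCategory.tensorIso C _ ParMonoidal.mon _ _ _ _ (involutorIso B)
    (involutorIso A)) ≪≫ lamP (dg B) (dg A)
  have hJ : J.hom = (involutor B ⅋ₘ involutor A) ≫ (lamP (dg B) (dg A)).hom := rfl
  have hι : J.hom ≫ dgMap (lamT B A).inv = involutor (B ⅋ A) := by
    rw [hJ, Category.assoc, ← reassoc_of% (ι_par B A), ← dgMap_comp, Iso.inv_hom_id, dgMap_id]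
    exact Category.comp_id _
  have hL : dgMap (daggerStarParIso B A).inv ▷ dg (dg B ⊗ dg A)
        ≫ dagCap (nestParTensor (ldual (dg A)).η (ldual (dg B)).η)
      = dg (lstar (dg (B ⅋ A))) ◁ dgMap (lamT B A).inv ≫ dagCap (ldual (dg (B ⅋ A))).η := by
    rw [← dagCap_whiskerRight, ← dagCap_whiskerLeft, ← daggerStarParIso_inv_η]
    rfl
  apply ((ldual (dg A)).par (ldual (dg B))).dagger.right_ext
  rw [← cancel_epi ((lstar A ⊗ lstar B) ◁ J.hom)]
  change _ ≫ _ ≫ dagCap (nestParTensor (ldual (dg A)).η (ldual (dg B)).η)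
    = _ ≫ _ ≫ dagCap (nestParTensor (ldual (dg A)).η (ldual (dg B)).η)
  simp only [comp_whiskerRight, Category.assoc, hL]
  rw [whisker_exchange_assoc, whisker_exchange_assoc, whisker_exchange_assoc,
    ← MonoidalCategory.whiskerLeft_comp_assoc, hι, ← MonoidalCategory.tensorHom_def_assoc,
    c.starConj_dagCap, c.starTensor_rightDual_ε, hJ, MonoidalCategory.whiskerLeft_comp,
    Category.assoc, whisker_exchange_assoc, dagCap_nestParTensor, nestCapPar_tensorHom,
    ← MonoidalCategory.tensorHom_def_assoc, ← MonoidalCategory.tensorHom_def_assoc,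
    c.starConj_dagCap, c.starConj_dagCap]

theorem Cyclor.conjugator_tensor (c : Cyclor C) (A B : C) :
    daggerStarTensor (lstar (dg A)) (lstar (dg B)) ≫ lstarMap (dgMap (daggerStarTensor B A))
        ≫ c.conjugator (A ⊗ B)
      = (c.conjugator A ⊗ₘ c.conjugator B) := by
  have h1 := nestCap_tensorHom (ldual (dg (lstar (dg B)))).ε (ldual (dg (lstar (dg A)))).ε (𝟙 _)
    (c.starConj B).hom (𝟙 _) (c.starConj A).hom
  have h2 := nestCap_tensorHom (c.rightDual B).ε (c.rightDual A).ε (c.conjugator B)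
    (𝟙 _) (c.conjugator A) (𝟙 _)
  have h3 : (𝟙 (lstar B) ⅋ₘ 𝟙 (lstar A)) = 𝟙 _ :=
    @MonoidalCategory.id_tensorHom_id C _ ParMonoidal.mon _ _
  simp only [MonoidalCategory.id_tensorHom_id, MonoidalCategory.whiskerLeft_id,
    Category.id_comp] at h1
  simp only [h3, id_whiskerRight, Category.id_comp, c.conjugator_ε] at h2
  apply (c.rightDual (A ⊗ B)).left_ext
  -- Replaces `(A ⊗ B)^*` by `B^* ⊕ A^*`, on which the right cap is a nesting.
  rw [← cancel_epi ((starParIso A B).inv ▷ _)]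
  simp only [MonoidalCategory.whiskerLeft_comp, Category.assoc]
  rw [c.conjugator_ε, whisker_exchange_assoc, lstarMap_ε, whisker_exchange_assoc,
    whisker_exchange_assoc, daggerStarTensor_ε, ← whisker_exchange_assoc,
    c.starParIso_inv_rightDual_ε, h2, ← h1]
  simp only [← comp_whiskerRight_assoc, reassoc_of% (c.starConj_par B A)]
  simp

theorem Cyclor.conjugator_par (c : Cyclor C) (A B : C) :
    (daggerStarParIso (lstar (dg B)) (lstar (dg A))).inv
        ≫ lstarMap (dgMap (daggerStarParIso A B).inv) ≫ c.conjugator (A ⅋ B)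
      = (c.conjugator A ⅋ₘ c.conjugator B) := by
  have h1 := nestCapPar_tensorHom (ldual (dg (lstar (dg B)))).ε (ldual (dg (lstar (dg A)))).ε
    (𝟙 _) (c.starConj B).hom (𝟙 _) (c.starConj A).hom
  have h2 := nestCapPar_tensorHom (c.rightDual B).ε (c.rightDual A).ε (c.conjugator B)
    (𝟙 _) (c.conjugator A) (𝟙 _)
  have h3 : (𝟙 (lstar (dg (lstar (dg A)))) ⅋ₘ 𝟙 (lstar (dg (lstar (dg B))))) = 𝟙 _ :=
    @MonoidalCategory.id_tensorHom_id C _ ParMonoidal.mon _ _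
  simp only [h3, MonoidalCategory.whiskerLeft_id, Category.id_comp] at h1
  simp only [MonoidalCategory.id_tensorHom_id, id_whiskerRight, Category.id_comp,
    c.conjugator_ε] at h2
  apply (c.rightDual (A ⅋ B)).left_ext
  rw [← cancel_epi ((starTensorIso B A).hom ▷ _)]
  simp only [starTensorIso_hom, MonoidalCategory.whiskerLeft_comp, Category.assoc]
  rw [c.conjugator_ε, whisker_exchange_assoc, lstarMap_ε, whisker_exchange_assoc,
    whisker_exchange_assoc, daggerStarParIso_inv_ε, ← whisker_exchange_assoc,
    c.starTensor_rightDual_ε, h2, ← h1]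
  simp only [← comp_whiskerRight_assoc, reassoc_of% (c.starConj_tensor B A)]
  simp

end ConjugatorCoherence

/-! ### The adjunction, the equivalence and the conjugation. -/

section Conjugation

open LinDistrib StarAutonomous DaggerLDC

variable {C : Type u} [Category.{v} C] [MonoidalCategory C] [ParMonoidal C] [LinDistrib C]
  [StarAutonomous C] [DaggerLDC C]

theorem Cyclor.compositeUnit_naturality (c : Cyclor C) {A B : C} (f : A ⟶ B) :
    f ≫ c.compositeUnit B = c.compositeUnit A ≫ lstarMap (dgMap (dgMap (lstarMap f))) := by
  unfold Cyclor.compositeUnit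
  rw [reassoc_of% (c.dualizor_naturality f), Category.assoc, ← lstarMap_comp, ← lstarMap_comp,
    involutorInv_naturality]

theorem Cyclor.compositeCounit_naturality (c : Cyclor C) {A B : C} (f : A ⟶ B) :
    dgMap (lstarMap (lstarMap (dgMap f))) ≫ c.compositeCounit B = c.compositeCounit A ≫ f := by
  unfold Cyclor.compositeCounit
  rw [← reassoc_of% @dgMap_comp, ← c.dualizor_naturality, dgMap_comp, Category.assoc,
    Category.assoc, involutorInv_naturality]

/-- Naturality of `d` at `ι⁻¹` brings `d_{A^*}` next to `(d_A)^*`, which cancel; `ι_dag` then makes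
the involutors cancel. -/
theorem Cyclor.dgMap_lstarMap_compositeUnit_compositeCounit (c : Cyclor C) (A : C) :
    dgMap (lstarMap (c.compositeUnit A)) ≫ c.compositeCounit (dg (lstar A))
      = 𝟙 (dg (lstar A)) := by
  unfold Cyclor.compositeUnit Cyclor.compositeCounit
  rw [lstarMap_comp, ← reassoc_of% @dgMap_comp, ← reassoc_of% (c.dualizor_naturality
    (involutorInv (lstar A))), c.dualizor_lstarMap_dualizor, Category.comp_id, dgMap_involutorInv,
    involutor_involutorInv]

theorem Cyclor.compositeUnit_lstarMap_dgMap_compositeCounit (c : Cyclor C) (A : C) :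
    c.compositeUnit (lstar (dg A)) ≫ lstarMap (dgMap (c.compositeCounit A))
      = 𝟙 (lstar (dg A)) := by
  unfold Cyclor.compositeUnit Cyclor.compositeCounit
  rw [dgMap_comp, dgMap_involutorInv, ← involutor_naturality, Category.assoc, ← lstarMap_comp,
    Category.assoc, involutor_involutorInv, Category.comp_id, c.dualizor_lstarMap_dualizor]

instance (c : Cyclor C) (A : C) : IsIso (c.compositeUnit A) :=
  inferInstanceAs (IsIso (c.dualizor A ≫ lstarMap (involutorInv (lstar A))))

instance (c : Cyclor C) (A : C) : IsIso (c.compositeCounit A) :=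
  inferInstanceAs (IsIso (dgMap (c.dualizor (dg A)) ≫ involutorInv A))

instance (c : Cyclor C) (A : C) : IsIso (c.omega A) :=
  c.omegaIso_hom A ▸ inferInstance

instance (c : Cyclor C) (A : C) : IsIso (c.conjugator A) := by
  unfold Cyclor.conjugator
  infer_instance

/-- The conjugator is a composite of isomorphisms, so a one-sided inverse suffices. -/
theorem Cyclor.conjugator_conjugatorInv (c : Cyclor C) (A : C) :
    c.conjugator A ≫ c.conjugatorInv A = 𝟙 (lstar (dg (lstar (dg A)))) := by
  rw [← cancel_mono (c.conjugator A), Category.assoc, c.conjugatorInv_conjugator,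
    Category.comp_id, Category.id_comp]

theorem Cyclor.conjugator_naturality (c : Cyclor C) {A B : C} (f : A ⟶ B) :
    lstarMap (dgMap (lstarMap (dgMap f))) ≫ c.conjugator B = c.conjugator A ≫ f := by
  unfold Cyclor.conjugator
  rw [reassoc_of% (c.omega_naturality (lstarMap (dgMap f))), c.compositeCounit_naturality,
    Category.assoc]

theorem Cyclor.lstarMap_dgMap_conjugator (c : Cyclor C) (A : C) :
    lstarMap (dgMap (c.conjugator A)) = c.conjugator (lstar (dg A)) := by
  -- Here `ω⁻¹` from `conjugatorInv` meets `ω` from the conjugator, and a triangle identity remains.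
  -- Both maps in the goal thus invert the same `conjugatorInv`.
  have h : c.conjugatorInv (lstar (dg A)) ≫ lstarMap (dgMap (c.conjugator A)) = 𝟙 _ := by
    rw [Cyclor.conjugatorInv, Cyclor.conjugator, dgMap_comp, lstarMap_comp, ← c.omegaIso_hom,
      Category.assoc, ← reassoc_of% @lstarMap_comp, ← dgMap_comp, Iso.inv_hom_id, dgMap_id,
      lstarMap_id, Category.id_comp, c.compositeUnit_lstarMap_dgMap_compositeCounit]
  rw [← Category.id_comp (lstarMap (dgMap (c.conjugator A))), ← c.conjugator_conjugatorInv,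
    Category.assoc, h, Category.comp_id]

/-- Naturality of `ω` at `ω_A⁻¹` turns the composite into `conjugatorInv` followed by `conjugator`.
-/
theorem Cyclor.compositeUnit_omega_compositeCounit (c : Cyclor C) (A : C) :
    (c.compositeUnit A ≫ c.omega (dg (lstar A)))
      ≫ (dgMap (lstarMap (c.omegaIso A).inv) ≫ c.compositeCounit A) = 𝟙 A := by
  rw [Category.assoc, ← reassoc_of% (c.omega_naturality (c.omegaIso A).inv), ← Category.assoc]
  exact c.conjugatorInv_conjugator A

theorem Cyclor.compositeCounit_compositeUnit_omega (c : Cyclor C) (A : C) :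
    (dgMap (lstarMap (c.omegaIso A).inv) ≫ c.compositeCounit A)
      ≫ (c.compositeUnit A ≫ c.omega (dg (lstar A))) = 𝟙 (dg (lstar (dg (lstar A)))) := by
  rw [← cancel_epi (c.compositeUnit A ≫ c.omega (dg (lstar A))), ← Category.assoc,
    c.compositeUnit_omega_compositeCounit, Category.id_comp, Category.comp_id]

/-- The conjugator as a natural isomorphism. -/
def Cyclor.conjugatorIso (c : Cyclor C) : daggerStar C ⋙ daggerStar C ≅ 𝟭 C :=
  NatIso.ofComponents
    (fun A => ⟨c.conjugator A, c.conjugatorInv A, c.conjugator_conjugatorInv A,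
      c.conjugatorInv_conjugator A⟩)
    (fun f => c.conjugator_naturality f)

/-- The comparison `(_)^{†*} ≅ (_)^{*†}` as a natural isomorphism. -/
def Cyclor.omegaNatIso (c : Cyclor C) : daggerStar C ≅ starDagger C :=
  NatIso.ofComponents c.omegaIso (fun f => by
    rw [c.omegaIso_hom, c.omegaIso_hom]
    exact c.omega_naturality f)

/-- The adjunction between `(_)^{*†}` and `(_)^{†*}`. -/
def Cyclor.adjunction (c : Cyclor C) : starDagger C ⊣ daggerStar C :=
  Adjunction.mkOfUnitCounit
    { unit := { app := c.compositeUnit, naturality := fun _ _ f => c.compositeUnit_naturality f }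
      counit :=
        { app := c.compositeCounit, naturality := fun _ _ f => c.compositeCounit_naturality f }
      left_triangle := by
        ext A
        exact (congrArg (_ ≫ ·) (Category.id_comp _)).trans
          (c.dgMap_lstarMap_compositeUnit_compositeCounit A)
      right_triangle := by
        ext A
        exact (congrArg (_ ≫ ·) (Category.id_comp _)).trans
          (c.compositeUnit_lstarMap_dgMap_compositeCounit A) }

/-- The functor `(_)^{†*}` is a conjugation. -/
def Cyclor.conjugation (c : Cyclor C) : LDCConjugation (daggerStar C) where
  χT := daggerStarTensorIso
  χP := daggerStarParIso
  ε := c.conjugatorIso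
  tensor :=
    { χ_natural := daggerStarTensor_naturality
      bar_ε := c.lstarMap_dgMap_conjugator
      assoc := daggerStarTensor_assoc
      ε_χ := c.conjugator_tensor }
  par :=
    { χ_natural := daggerStarParIso_inv_naturality
      bar_ε := c.lstarMap_dgMap_conjugator
      assoc := daggerStarParIso_inv_assoc
      ε_χ := c.conjugator_par }
  δ_left := daggerStar_δL
  δ_right := daggerStar_δR

end Conjugation

theorem mainTheorem2 {C : Type u} [Category.{v} C] [MonoidalCategory C] [ParMonoidal C]
    [LinDistrib C] [StarAutonomous C] [DaggerLDC C] (c : Cyclor C) (hc : c.PreservedByDagger) :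
    ∃ (adj : starDagger C ⊣ daggerStar C) (ω : daggerStar C ≅ starDagger C)
      (K : LDCConjugation (daggerStar C)),
      -- the composite adjunction is an equivalence with the expected unit and counit
      (∀ A : C, adj.unit.app A = c.compositeUnit A ∧ IsIso (adj.unit.app A)) ∧
      (∀ A : C, adj.counit.app A = c.compositeCounit A ∧ IsIso (adj.counit.app A)) ∧
      -- the comparison isomorphism is the one obtained from the cyclor
      (∀ A : C, ω.hom.app A = c.omega A) ∧
      -- the unit and counit straightened onto the functor `(_)^{*†}` are mutually inverse
      (∀ A : C,
        (adj.unit.app A ≫ ω.hom.app ((starDagger C).obj A)) ≫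
            ((starDagger C).map (ω.inv.app A) ≫ adj.counit.app A) = 𝟙 A ∧
        ((starDagger C).map (ω.inv.app A) ≫ adj.counit.app A) ≫
            (adj.unit.app A ≫ ω.hom.app ((starDagger C).obj A))
          = 𝟙 ((starDagger C).obj ((starDagger C).obj A))) ∧
      -- straightened onto `(_)^{†*}`, they are the inverse and the forward conjugator
      (∀ A : C, K.ε.hom.app A = ω.hom.app ((daggerStar C).obj A) ≫ adj.counit.app A) ∧
      (∀ A : C, K.ε.inv.app A = adj.unit.app A ≫ (daggerStar C).map (ω.inv.app A)) ∧
      -- the conjugating laxors are those of the composite of the two functors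
      (∀ A B : C, (K.χT A B).hom = daggerStarTensor A B) ∧
      (∀ A B : C, (K.χP A B).hom = daggerStarPar A B) := by
  -- `omegaNatIso` is built from the uniqueness of left duals, so its agreement with the explicit
  -- composite `ω` is not definitional.
  have e : ∀ A : C, c.omegaNatIso.hom.app A = c.omega A := c.omegaIso_hom
  refine ⟨c.adjunction, c.omegaNatIso, c.conjugation, fun A => ⟨rfl, ?_⟩, fun A => ⟨rfl, ?_⟩,
    e, fun A => ⟨?_, ?_⟩, fun A => ?_, fun A => rfl, fun A B => rfl, fun A B => rfl⟩
  · exact inferInstanceAs (IsIso (c.compositeUnit A))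
  · exact inferInstanceAs (IsIso (c.compositeCounit A))
  · rw [e]
    exact c.compositeUnit_omega_compositeCounit A
  · rw [e]
    exact c.compositeCounit_compositeUnit_omega A
  · rw [e]
    rfl
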